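/- **Conventions.** A *pattern* is a set $S\subset[0,1]^2$ whose boundary has Lebesgue measure zero. Let $\{X_{ij}\}_{i,j\ge 1}$ be an iid array of real or complex random variables with finite moments of all orders, mean $0$ and variance $1$. The *patterned matrix* $X_{N,S}$ is the $N\times N$ matrix with $(X_{N,S})_{ij}=X_{ij}/\sqrt N$ if $\left(\frac{j-1}N,\frac jN\right)\times\left(\frac{N-i}N,\frac{N-i+1}N\right)\cap S$ has non-empty interior, and $(X_{N,S})_{ij}=0$ otherwise. It is *fully filled square* if $S=[0,1]^2$. The array may be a different one, with a different law, for each matrix, but for one matrix it does not depend on $N$. A *configuration* $C$ is a finite sequence in the symbols $x,x^*$, and $X^C$ is the matrix product obtained by replacing $x$ by the matrix $X$ and $x^*$ by its adjoint $X^*$ (the empty product is $I$). We write $\mathrm{tr}=\frac1N\mathrm{Tr}$. **Theorem 4.5 (Asymptotic freeness).** Let $S^1=(S^1_1,\dots,S^1_{q_1})$ be a tuple of patterns and let $S^2=(S^2_1,\dots,S^2_{q_2})$ with $S^2_i=[0,1]^2$ for every $i$. Suppose that for every $N$ the patterned matrices $X_{N,S^g_i}$ ($g\in\{1,2\}$,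 $1\le i\le q_g$) are independent. Then the following hold. 1. For every $g$, $i$ and every configuration $C$ the limit $m^{C}_{S^g_i}=\lim_{N\to\infty}E[\mathrm{tr}(X_{N,S^g_i}^{C})]$ exists. For all $d\ge1$, all configurations $C_1,\dots,C_d$, all $g_1,\dots,g_d\in\{1,2\}$ with $g_k\ne g_{k+1}$ for $1\le k<d$, and all indices $1\le i_k\le q_{g_k}$, $$E\Big[\mathrm{tr}\Big(\big(X_{N,S^{g_1}_{i_1}}^{C_1}-m^{C_1}_{S^{g_1}_{i_1}}I\big)\cdots\big(X_{N,S^{g_d}_{i_d}}^{C_d}-m^{C_d}_{S^{g_d}_{i_d}}I\big)\Big)\Big]\longrightarrow0\qquad(N\to\infty).$$ 2. The two groups of matrices $\{X_{N,S^1_i}\}_i$ and $\{X_{N,S^2_i}\}_i$ are asymptotically free. That is, for every noncommutative polynomial $P$ in the variables $x_{g,i},x_{g,i}^*$ the limit $\tau(P)$ of $E[\mathrm{tr}\,P]$, with the matrices $X_{N,S^g_i}$ and their adjoints substituted for the variables, exists; and $\tau(P_1\cdots P_d)=0$ whenever $d\ge1$, each $P_k$ is a polynomial in the variables of the single group $g_k$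 with $\tau(P_k)=0$, and $g_k\neq g_{k+1}$ for $1\le k<d$. -/

import Mathlib

open MeasureTheory ProbabilityTheory Filter Topology

noncomputable section

namespace PatternedMatrices

/-- The unit square `[0,1] × [0,1]` of the plane. -/
def unitSquare : Set (ℝ × ℝ) := Set.Icc 0 1 ×ˢ Set.Icc 0 1

/-- A pattern: a subset of the unit square whose boundary is Lebesgue null. -/
structure IsPattern (S : Set (ℝ × ℝ)) : Prop where
  subset : S ⊆ unitSquare
  frontier_null : volume (frontier S) = 0

/-- The open grid cell `(a/N, (a+1)/N) × (b/N, (b+1)/N)`. -/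
def gridBox (N a b : ℕ) : Set (ℝ × ℝ) :=
  Set.Ioo ((a : ℝ) / N) (((a : ℝ) + 1) / N) ×ˢ Set.Ioo ((b : ℝ) / N) (((b : ℝ) + 1) / N)

section Matrices

variable {𝕜 : Type*} [RCLike 𝕜] {Ω : Type*}

open Classical in
/-- The `N × N` approximating (patterned random) matrix of `S`, filled from the array `ξ`.
Rows and columns are numbered from `0`, so that the row `i` and the column `j` correspond to the
cell in horizontal position `j` and in vertical position `N - (i + 1)`: the matrix is a picture of
the pattern, drawn with its first row on top. -/
def patternedMatrix (N : ℕ) (S : Set (ℝ × ℝ)) (ξ : ℕ → ℕ → Ω → 𝕜) (ω : Ω) :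
    Matrix (Fin N) (Fin N) 𝕜 :=
  Matrix.of fun i j =>
    if (interior (gridBox N j (N - (i + 1)) ∩ S)).Nonempty
    then ξ i j ω / ((Real.sqrt N : ℝ) : 𝕜) else 0

/-- The underlying random variables of one patterned matrix: a doubly infinite array of iid real
or complex random variables with finite moments of all orders, mean `0` and variance `1`. -/
structure IsEntryArray [MeasurableSpace Ω] (μ : Measure Ω) (ξ : ℕ → ℕ → Ω → 𝕜) : Prop where
  measurable : ∀ i j, Measurable (ξ i j)
  indep : iIndepFun (fun ij : ℕ × ℕ => ξ ij.1 ij.2) μ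
  identDistrib : ∀ i j i' j', IdentDistrib (ξ i j) (ξ i' j') μ μ
  memLp : ∀ (i j k : ℕ), MemLp (ξ i j) k μ
  mean : ∀ i j, ∫ ω, ξ i j ω ∂μ = 0
  variance : ∀ i j, ∫ ω, ‖ξ i j ω‖ ^ 2 ∂μ = 1

/-- The expected normalized trace of a random `N × N` matrix. -/
def expTr [MeasurableSpace Ω] (μ : Measure Ω) {N : ℕ} (M : Ω → Matrix (Fin N) (Fin N) 𝕜) : 𝕜 :=
  ∫ ω, (N : 𝕜)⁻¹ * (M ω).trace ∂μ

/-- The value of a letter at a matrix: `x` (`false`) is sent to `A`, `x*` (`true`) to the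
adjoint of `A`. -/
def starLetter {N : ℕ} (A : Matrix (Fin N) (Fin N) 𝕜) (s : Bool) : Matrix (Fin N) (Fin N) 𝕜 :=
  if s then A.conjTranspose else A

/-- A configuration: a finite sequence in `x` (`false`) and `x*` (`true`). -/
abbrev Configuration : Type := List Bool

/-- The product `A ^ C` of copies of `A` and its adjoint prescribed by a configuration `C`. -/
def configPow {N : ℕ} (A : Matrix (Fin N) (Fin N) 𝕜) (C : Configuration) :
    Matrix (Fin N) (Fin N) 𝕜 :=
  (C.map (starLetter A)).prod

/-- The noncommutative polynomials in the variables `x i` and `x i *`, that is, in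
`FreeAlgebra.ι 𝕜 (i, false)` and `FreeAlgebra.ι 𝕜 (i, true)`. -/
abbrev NCPoly (𝕜 : Type*) [RCLike 𝕜] (I : Type*) : Type _ := FreeAlgebra 𝕜 (I × Bool)

/-- Evaluation of a noncommutative polynomial at a family of matrices and their adjoints. -/
def evalPoly {I : Type*} {N : ℕ} (A : I → Matrix (Fin N) (Fin N) 𝕜) :
    NCPoly 𝕜 I →ₐ[𝕜] Matrix (Fin N) (Fin N) 𝕜 :=
  FreeAlgebra.lift 𝕜 fun l => starLetter (A l.1) l.2

/-- The polynomials in the variables (and their adjoints) of the group `g`, the variable `i`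
belonging to the group `c i`. -/
def groupAlgebra {I G : Type*} (c : I → G) (g : G) : Subalgebra 𝕜 (NCPoly 𝕜 I) :=
  Algebra.adjoin 𝕜 {P | ∃ i s, c i = g ∧ P = FreeAlgebra.ι 𝕜 (i, s)}

/-- The algebras generated by the groups of variables are free with respect to `τ`: `τ` vanishes
on every nonempty product of polynomials, each of them of vanishing `τ` and in the variables of one
group, consecutive factors coming from different groups. -/
def GroupsFree {I G : Type*} (c : I → G) (τ : NCPoly 𝕜 I →ₗ[𝕜] 𝕜) : Prop :=
  ∀ L : List (G × NCPoly 𝕜 I), L ≠ [] → L.IsChain (fun a b => a.1 ≠ b.1) →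
    (∀ a ∈ L, a.2 ∈ groupAlgebra (𝕜 := 𝕜) c a.1 ∧ τ a.2 = 0) → τ (L.map Prod.snd).prod = 0

/-- Asymptotic freeness of groups of random matrices (the matrix `i` belonging to the group `c i`):
the matrices together converge in `*`-distribution, and the groups are free in the limit. -/
def AsymptoticallyFree [MeasurableSpace Ω] {I G : Type*} (μ : Measure Ω) (c : I → G)
    (A : ∀ N : ℕ, I → Ω → Matrix (Fin N) (Fin N) 𝕜) : Prop :=
  ∃ τ : NCPoly 𝕜 I →ₗ[𝕜] 𝕜,
    (∀ P, Tendsto (fun N => expTr μ fun ω => evalPoly (fun i => A N i ω) P) atTop (𝓝 (τ P))) ∧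
      GroupsFree c τ

end Matrices

end PatternedMatrices

end

open PatternedMatrices

/-! The proof is the moment method, followed by an algebraic induction.

The expected trace of a word is a sum over closed walks on the indices. Entries are independent and
centered, so a walk contributes only if each of its entries occurs at least twice. A connected graph
with `k` edges has at most `k + 1` vertices; hence a contributing walk of length `n` visits at most
`n/2 + 1` vertices. Each moment is `O(N^(-n/2))`, so walks with fewer vertices are negligible. The
extremal ones run around trees: such a walk returns along its first edge exactly once, in the
opposite direction, and splits there into two closed walks without common entries (`exists_split`).
For walks from a fixed `a` this gives, up to `O(N^(-1/2))`, the recursion `diagMoment_recursion`: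
`m(l w)(a)` is the sum over `w = u l* v` of `(1/N ∑_b mask(a,b) m(u)(b)) m(v)(a)`.

Since the boundaries of the patterns are null, the masks, seen as step functions on the square,
converge almost everywhere. Induction on the recursion with dominated convergence gives convergence
of the diagonal moments, hence of all traces, to a functional `τ`. For a letter of a full matrix the
mask is `1`, the inner average no longer depends on `a`, and averaging over `a` yields the
Schwinger-Dyson equation `τ(l w) = ∑ τ(u) τ(v)` (`limit_cons_eq_splitSum`).

Freeness follows from these equations and traciality alone (`apply_centeredProd_aux`), by induction
on the total length of an alternating product of centered words. Rotate a letter `l` of a full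
matrix to the front and expand. If `l*` lies in the same word, centering leaves a shorter
alternating product; if it lies in another word, one factor of the term is the trace of a shorter
alternating product, up to recentering both ends. Everything vanishes by induction. -/

noncomputable section

namespace PatternedMatrices

/-! ### Walks, the entries along them, and connectedness. -/

section Walks

variable {I α : Type*}

/-- The matrix entry read by the letter `l` on a step from `a` to `b`, and whether it is read
conjugated. -/
def step (l : I × Bool) (a b : α) : (I × α × α) × Bool :=
  ((l.1, if l.2 then (b, a) else (a, b)), l.2)

/-- The occurrences of matrix entries along the walk which starts at `a`, then visits `t`. -/
def occ : List (I × Bool) → α → List α → List ((I × α × α) × Bool)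
  | l :: w, a, b :: t => step l a b :: occ w b t
  | _, _, _ => []

/-- The last vertex of the walk which starts at `a`, then visits `t`. -/
def walkEnd : α → List α → α
  | a, [] => a
  | _, b :: t => walkEnd b t

/-- The undirected edge of an entry. -/
def edge (e : I × α × α) : Sym2 α := s(e.2.1, e.2.2)

lemma edge_step (l : I × Bool) (a b : α) : edge (step l a b).1 = s(a, b) := by
  obtain ⟨p, s⟩ := l
  cases s <;> simp [edge, step, Sym2.eq_swap]

lemma occ_append {u : List (I × Bool)} {t : List α} (h : u.length = t.length)
    (v : List (I × Bool)) (a : α) (t' : List α) :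
    occ (u ++ v) a (t ++ t') = occ u a t ++ occ v (walkEnd a t) t' := by
  induction u generalizing a t with
  | nil =>
    obtain rfl : t = [] := by simpa using h.symm
    simp [occ, walkEnd]
  | cons l u ih =>
    cases t with
    | nil => simp at h
    | cons b t =>
      simp only [List.length_cons, Nat.add_right_cancel_iff] at h
      simp [occ, walkEnd, ih h]

lemma walkEnd_append (a : α) (t t' : List α) :
    walkEnd a (t ++ t') = walkEnd (walkEnd a t) t' := by
  induction t generalizing a with
  | nil => rfl
  | cons b t ih => simp [walkEnd, ih]

lemma walkEnd_mem (a : α) (t : List α) : walkEnd a t ∈ a :: t := by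
  induction t generalizing a with
  | nil => simp [walkEnd]
  | cons b t ih => exact List.mem_cons_of_mem _ (ih b)

lemma length_occ {w : List (I × Bool)} {t : List α} (h : w.length = t.length) (a : α) :
    (occ w a t).length = w.length := by
  induction w generalizing a t with
  | nil => simp [occ]
  | cons l w ih =>
    cases t with
    | nil => simp at h
    | cons b t =>
      simp only [List.length_cons, Nat.add_right_cancel_iff] at h
      simp [occ, ih h]

lemma mem_of_mem_occ {w : List (I × Bool)} {a : α} {t : List α} {o : (I × α × α) × Bool}
    (ho : o ∈ occ w a t) : o.1.2.1 ∈ a :: t ∧ o.1.2.2 ∈ a :: t := by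
  induction w generalizing a t with
  | nil => simp [occ] at ho
  | cons l w ih =>
    cases t with
    | nil => simp [occ] at ho
    | cons b t =>
      simp only [occ, List.mem_cons] at ho
      rcases ho with rfl | ho
      · obtain ⟨p, s⟩ := l
        cases s <;> simp [step]
      · exact ⟨List.mem_cons_of_mem _ (ih ho).1, List.mem_cons_of_mem _ (ih ho).2⟩

/-- A set of vertices which is closed under the given edges, with at most one vertex more than
there are edges. -/
lemma exists_closed_finset [Fintype α] [DecidableEq α] (E : Finset (Sym2 α)) (r : α) :
    ∃ W : Finset α, r ∈ W ∧ W.card ≤ E.card + 1 ∧ ∀ x y, x ∈ W → s(x, y) ∈ E → y ∈ W := by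
  classical
  let F : Finset α → Finset (Sym2 α) := fun W => E.filter fun e => ∀ v ∈ e, v ∈ W
  -- A maximal member of `P` is closed: an edge leaving it would bring in one new vertex together
  -- with at least one new inner edge, which preserves the inequality.
  let P : Finset (Finset α) := Finset.univ.filter fun W => r ∈ W ∧ W.card ≤ (F W).card + 1
  have hP : P.Nonempty := ⟨{r}, by simp [P]⟩
  obtain ⟨W, hW, hmax⟩ := P.exists_max_image Finset.card hP
  simp only [P, Finset.mem_filter, Finset.mem_univ, true_and] at hW hmax
  refine ⟨W, hW.1, hW.2.trans (by gcongr; exact Finset.filter_subset _ _), ?_⟩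
  intro x y hx he
  by_contra hy
  have hsub : insert s(x, y) (F W) ⊆ F (insert y W) := by
    intro e h
    rcases Finset.mem_insert.1 h with rfl | h
    · simp only [F, Finset.mem_filter, he, true_and, Sym2.mem_iff]
      rintro v (rfl | rfl) <;> simp [hx]
    · simp only [F, Finset.mem_filter] at h ⊢
      exact ⟨h.1, fun v hv => Finset.mem_insert_of_mem (h.2 v hv)⟩
  have hnot : s(x, y) ∉ F W := fun h => hy ((Finset.mem_filter.1 h).2 y (by simp))
  have h1 := Finset.card_le_card hsub
  rw [Finset.card_insert_of_notMem hnot] at h1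
  have h2 := hmax (insert y W) ⟨by simp [hW.1], by
    rw [Finset.card_insert_of_notMem hy]; omega⟩
  rw [Finset.card_insert_of_notMem hy] at h2
  omega

/-- A walk along the edges of `E` which meets a set closed under `E` stays in that set. -/
lemma walk_subset {E : Finset (Sym2 α)} {W : Finset α}
    (hW : ∀ x y, x ∈ W → s(x, y) ∈ E → y ∈ W) {w : List (I × Bool)} {a : α} {t : List α}
    (h : w.length = t.length) (hE : ∀ o ∈ occ w a t, edge o.1 ∈ E) {z : α} (hz : z ∈ a :: t)
    (hzW : z ∈ W) : ∀ y ∈ a :: t, y ∈ W := by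
  induction w generalizing a t z with
  | nil =>
    obtain rfl : t = [] := by simpa using h.symm
    simp only [List.mem_singleton] at hz
    simpa [← hz] using hzW
  | cons l w ih =>
    cases t with
    | nil => simp at h
    | cons b t =>
      simp only [List.length_cons, Nat.add_right_cancel_iff] at h
      simp only [occ, List.mem_cons, forall_eq_or_imp, edge_step] at hE
      have hb : ∀ y ∈ b :: t, y ∈ W := by
        rcases List.mem_cons.1 hz with rfl | hz
        · exact ih h hE.2 (z := b) (by simp) (hW _ _ hzW hE.1)
        · exact ih h hE.2 hz hzW
      intro y hy
      rcases List.mem_cons.1 hy with rfl | hy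
      · exact hW b _ (hb b (by simp)) (by rw [Sym2.eq_swap]; exact hE.1)
      · exact hb y hy

lemma two_mul_card_toFinset_le {β : Type*} [DecidableEq β] [BEq β] [LawfulBEq β] {L : List β}
    (h : ∀ e ∈ L, 2 ≤ L.count e) : 2 * L.toFinset.card ≤ L.length := by
  obtain rfl : ‹BEq β› = instBEqOfDecidableEq := lawful_beq_subsingleton _ _
  rw [← List.sum_toFinset_count_eq_length, mul_comm, ← smul_eq_mul]
  exact Finset.card_nsmul_le_sum _ _ _ fun e he => h e (List.mem_toFinset.1 he)

/-- The equality case of the preceding bound: a third occurrence of anything would make the list too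
long. -/
lemma count_eq_two {β : Type*} [DecidableEq β] [BEq β] [LawfulBEq β] {L : List β}
    (h : ∀ e ∈ L, 2 ≤ L.count e) (hL : L.length ≤ 2 * L.toFinset.card) {e : β} (he : e ∈ L) :
    L.count e = 2 := by
  obtain rfl : ‹BEq β› = instBEqOfDecidableEq := lawful_beq_subsingleton _ _
  by_contra hne
  have hlt : ∑ _e ∈ L.toFinset, 2 < ∑ e ∈ L.toFinset, L.count e :=
    Finset.sum_lt_sum (fun e he => h e (List.mem_toFinset.1 he))
      ⟨e, List.mem_toFinset.2 he, lt_of_le_of_ne (h e he) (Ne.symm hne)⟩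
  rw [List.sum_toFinset_count_eq_length, Finset.sum_const, smul_eq_mul] at hlt
  omega

/-- Turns a repeated entry into a simultaneous cut of the word and of the walk. -/
lemma exists_split_of_occ_eq {w : List (I × Bool)} {b : α} {t : List α}
    (h : w.length = t.length) {O₁ O₂ : List ((I × α × α) × Bool)} {o : (I × α × α) × Bool}
    (ho : occ w b t = O₁ ++ o :: O₂) :
    ∃ u l v t₁ c t₂, w = u ++ l :: v ∧ t = t₁ ++ c :: t₂ ∧ u.length = t₁.length ∧
      v.length = t₂.length ∧
      O₁ = occ u b t₁ ∧ o = step l (walkEnd b t₁) c ∧ O₂ = occ v c t₂ := by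
  induction O₁ generalizing w b t with
  | nil =>
    cases w with
    | nil => simp [occ] at ho
    | cons l w =>
      cases t with
      | nil => simp at h
      | cons c t =>
        simp only [occ, List.nil_append, List.cons.injEq] at ho
        simp only [List.length_cons, Nat.add_right_cancel_iff] at h
        exact ⟨[], l, w, [], c, t, by simp, by simp, rfl, h, by simp [occ], ho.1.symm, ho.2.symm⟩
  | cons o₁ O₁ ih =>
    cases w with
    | nil => simp [occ] at ho
    | cons l w =>
      cases t with
      | nil => simp at h
      | cons c t =>
        simp only [occ, List.cons_append, List.cons.injEq] at ho
        simp only [List.length_cons, Nat.add_right_cancel_iff] at h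
        obtain ⟨u, l', v, t₁, c', t₂, rfl, rfl, h1, h2, h3, h4, h5⟩ := ih h ho.2
        exact ⟨l :: u, l', v, c :: t₁, c', t₂, by simp, by simp, by simp [h1], h2,
          by simp [occ, ho.1, h3], by simpa [walkEnd] using h4, h5⟩

end Walks

/-! ### Counting walks by the number of their vertices. -/

/-- The finite set of lists of length `n`. -/
def listsOfLength (α : Type*) [Fintype α] [DecidableEq α] : ℕ → Finset (List α)
  | 0 => {[]}
  | n + 1 => (Finset.univ ×ˢ listsOfLength α n).image fun x => x.1 :: x.2

section Lists

variable {α : Type*} [Fintype α] [DecidableEq α] {M : Type*} [AddCommMonoid M]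

lemma mem_listsOfLength {n : ℕ} {t : List α} : t ∈ listsOfLength α n ↔ t.length = n := by
  induction n generalizing t with
  | zero => simp [listsOfLength]
  | succ n ih =>
    cases t with
    | nil => simp [listsOfLength]
    | cons b t => simp [listsOfLength, ih]

lemma sum_listsOfLength_succ (n : ℕ) (f : List α → M) :
    ∑ t ∈ listsOfLength α (n + 1), f t = ∑ b, ∑ t ∈ listsOfLength α n, f (b :: t) := by
  rw [listsOfLength, Finset.sum_image, Finset.sum_product]
  rintro ⟨b, t⟩ - ⟨b', t'⟩ - h
  simpa using h

lemma sum_listsOfLength_add (m n : ℕ) (f : List α → M) :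
    ∑ t ∈ listsOfLength α (m + n), f t =
      ∑ t ∈ listsOfLength α m, ∑ t' ∈ listsOfLength α n, f (t ++ t') := by
  induction m generalizing f with
  | zero => simp [listsOfLength]
  | succ m ih =>
    rw [Nat.add_right_comm, sum_listsOfLength_succ, sum_listsOfLength_succ]
    exact Finset.sum_congr rfl fun b _ => ih _

/-- Each step either reuses one of at most `k` known vertices, or spends one of the `r` permitted
new ones, with at most `card α` choices. The set `s` of vertices already seen grows along the
induction. -/
lemma card_filter_listsOfLength_le [Nonempty α] (n k r : ℕ) (s : Finset α) (hs : s.card + r ≤ k) :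
    ((listsOfLength α n).filter fun t => (s ∪ t.toFinset).card ≤ s.card + r).card ≤
      (k + 1) ^ n * Fintype.card α ^ r := by
  induction n generalizing s r with
  | zero =>
    refine (Finset.card_filter_le _ _).trans ?_
    simpa [listsOfLength] using Nat.one_le_pow _ _ Fintype.card_pos
  | succ n ih =>
    rw [Finset.card_filter, sum_listsOfLength_succ]
    simp_rw [← Finset.card_filter]
    rw [← Finset.sum_add_sum_compl s]
    have h1 : ∑ b ∈ s, ((listsOfLength α n).filter
        fun t => (s ∪ (b :: t).toFinset).card ≤ s.card + r).card ≤
        k * ((k + 1) ^ n * Fintype.card α ^ r) := by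
      refine (Finset.sum_le_card_nsmul _ _ ((k + 1) ^ n * Fintype.card α ^ r) ?_).trans ?_
      · intro b hb
        refine le_trans (le_of_eq ?_) (ih r s hs)
        congr 1
        refine Finset.filter_congr fun t _ => ?_
        rw [List.toFinset_cons, Finset.union_insert, Finset.insert_eq_of_mem (by simp [hb])]
      · rw [smul_eq_mul]
        gcongr
        omega
    have h2 : ∑ b ∈ sᶜ, ((listsOfLength α n).filter
        fun t => (s ∪ (b :: t).toFinset).card ≤ s.card + r).card ≤
        (k + 1) ^ n * Fintype.card α ^ r := by
      cases r with
      | zero =>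
        rw [Finset.sum_eq_zero]
        · simp
        intro b hb
        rw [Finset.card_eq_zero, Finset.filter_eq_empty_iff]
        intro t _ h
        have h3 : insert b s ⊆ s ∪ (b :: t).toFinset := by
          intro x hx
          rcases Finset.mem_insert.1 hx with rfl | hx <;> simp [*]
        have h4 := Finset.card_le_card h3
        rw [Finset.card_insert_of_notMem (Finset.mem_compl.1 hb)] at h4
        omega
      | succ r =>
        refine (Finset.sum_le_card_nsmul _ _ ((k + 1) ^ n * Fintype.card α ^ r) ?_).trans ?_
        · intro b hb
          have hc : (insert b s).card = s.card + 1 :=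
            Finset.card_insert_of_notMem (Finset.mem_compl.1 hb)
          refine le_trans (le_of_eq ?_) (ih r (insert b s) (by omega))
          congr 1
          refine Finset.filter_congr fun t _ => ?_
          rw [List.toFinset_cons, Finset.union_insert, Finset.insert_union, hc]
          omega
        · rw [smul_eq_mul]
          calc _ ≤ Fintype.card α * ((k + 1) ^ n * Fintype.card α ^ r) :=
                Nat.mul_le_mul_right _ (Finset.card_le_univ sᶜ)
            _ = _ := by ring
    calc _ ≤ _ := Nat.add_le_add h1 h2
      _ = _ := by ring

end Lists

/-! ### Moments of walks and the tree recursion. -/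

/-- The properties of the joint moments of independent centered entries of variance `mask / N` that
determine the asymptotics of the traces of words. -/
structure EntryMoments {I 𝕜 : Type*} [RCLike 𝕜] (K : ℕ → ℝ) (N : ℕ)
    (mask : I × Fin N × Fin N → 𝕜) (val : List ((I × Fin N × Fin N) × Bool) → 𝕜) : Prop where
  perm : ∀ {O O'}, O.Perm O' → val O = val O'
  disjoint : ∀ {O O'}, (∀ o ∈ O, ∀ o' ∈ O', o.1 ≠ o'.1) → val (O ++ O') = val O * val O'
  nil : val [] = 1
  single : ∀ e s, val [(e, s)] = 0
  pair : ∀ e s, val [(e, s), (e, !s)] = mask e / N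
  mask_le : ∀ e, ‖mask e‖ ≤ 1
  bound : ∀ O, ‖val O‖ ≤ K O.length / √N ^ O.length

/-- The normalized contribution of the closed walks from `a` to the word `w`. -/
def diagMoment {I 𝕜 : Type*} [RCLike 𝕜] {N : ℕ}
    (val : List ((I × Fin N × Fin N) × Bool) → 𝕜) (w : List (I × Bool)) (a : Fin N) : 𝕜 :=
  ∑ t ∈ listsOfLength (Fin N) w.length, if walkEnd a t = a then val (occ w a t) else 0

/-- The sum of `f u v` over the ways of writing a list as `u ++ l :: v`. -/
def splitSum {β M : Type*} [DecidableEq β] [AddCommMonoid M] (l : β) (f : List β → List β → M)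
    (w : List β) : M :=
  ∑ j ∈ Finset.range w.length, if w[j]? = some l then f (w.take j) (w.drop (j + 1)) else 0

namespace EntryMoments

variable {I 𝕜 : Type*} [RCLike 𝕜] [DecidableEq I] {K : ℕ → ℝ} {N : ℕ}
  {mask : I × Fin N × Fin N → 𝕜} {val : List ((I × Fin N × Fin N) × Bool) → 𝕜}

/-- An entry that occurs once splits off as an independent factor of mean zero. -/
lemma two_le_count (hv : EntryMoments K N mask val) {O : List ((I × Fin N × Fin N) × Bool)}
    (hO : val O ≠ 0) : ∀ e ∈ O.map Prod.fst, 2 ≤ (O.map Prod.fst).count e := by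
  intro e he
  by_contra hlt
  have h1 : (O.map Prod.fst).count e = 1 := by
    have := List.count_pos_iff.2 he
    omega
  obtain ⟨⟨e', s⟩, ho, rfl⟩ := List.mem_map.1 he
  obtain ⟨O₁, O₂, rfl⟩ := List.append_of_mem ho
  simp only [List.map_append, List.map_cons, List.count_append, List.count_cons_self] at h1
  have h2 : e' ∉ O₁.map Prod.fst := List.count_eq_zero.1 (by omega)
  have h3 : e' ∉ O₂.map Prod.fst := List.count_eq_zero.1 (by omega)
  apply hO
  rw [hv.perm (List.perm_middle (l₁ := O₁) (l₂ := O₂)), ← List.singleton_append, hv.disjoint,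
    hv.single, zero_mul]
  intro o ho o' ho'
  obtain rfl := List.mem_singleton.1 ho
  rintro h
  rcases List.mem_append.1 ho' with h' | h'
  · exact h2 (List.mem_map.2 ⟨o', h', h.symm⟩)
  · exact h3 (List.mem_map.2 ⟨o', h', h.symm⟩)

/-- A walk is connected, and distinct edges come from distinct entries. -/
lemma card_vertices_le_aux {w : List (I × Bool)} {a : Fin N} {t : List (Fin N)}
    (h : w.length = t.length) :
    (a :: t).toFinset.card ≤ ((occ w a t).map Prod.fst).toFinset.card + 1 := by
  obtain ⟨W, ha, hW, hcl⟩ :=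
    exists_closed_finset ((((occ w a t).map Prod.fst).toFinset).image edge) a
  have hs := walk_subset hcl h (fun o ho => Finset.mem_image_of_mem _ (by
    rw [List.mem_toFinset]; exact List.mem_map_of_mem ho)) (z := a) (by simp) ha
  refine (Finset.card_le_card (t := W) fun y hy => hs y (List.mem_toFinset.1 hy)).trans
    (hW.trans ?_)
  gcongr
  exact Finset.card_image_le

/-- A walk with a nonzero moment visits few vertices. -/
lemma card_vertices_le (hv : EntryMoments K N mask val) {w : List (I × Bool)} {a : Fin N}
    {t : List (Fin N)} (h : w.length = t.length) (h0 : val (occ w a t) ≠ 0) :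
    2 * (a :: t).toFinset.card ≤ w.length + 2 := by
  have h1 := card_vertices_le_aux (a := a) h
  have h2 := two_mul_card_toFinset_le (hv.two_le_count h0)
  rw [List.length_map, length_occ h] at h2
  omega

omit [DecidableEq I] in
/-- The pairing of the first step of a walk with its way back factors the moment. -/
lemma factor (hv : EntryMoments K N mask val) {l : I × Bool} {a b : Fin N}
    {O₁ O₂ : List ((I × Fin N × Fin N) × Bool)}
    (h1 : (step l a b).1 ∉ O₁.map Prod.fst) (h2 : (step l a b).1 ∉ O₂.map Prod.fst)
    (h12 : ∀ o ∈ O₁, ∀ o' ∈ O₂, o.1 ≠ o'.1) :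
    val (step l a b :: (O₁ ++ step (l.1, !l.2) b a :: O₂)) =
      mask (step l a b).1 / N * (val O₁ * val O₂) := by
  have hs : step (l.1, !l.2) b a = ((step l a b).1, !(step l a b).2) := by
    obtain ⟨p, s⟩ := l
    cases s <;> simp [step]
  rw [hs, hv.perm (O' := [((step l a b).1, (step l a b).2), ((step l a b).1, !(step l a b).2)] ++
    (O₁ ++ O₂)) (by simp [List.perm_middle]), hv.disjoint, hv.pair, hv.disjoint h12]
  intro o ho o' ho'
  have : o.1 = (step l a b).1 := by
    simp only [List.mem_cons, List.not_mem_nil, or_false] at ho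
    rcases ho with rfl | rfl <;> rfl
  rw [this]
  intro h
  rcases List.mem_append.1 ho' with h' | h'
  · exact h1 (List.mem_map.2 ⟨o', h', h.symm⟩)
  · exact h2 (List.mem_map.2 ⟨o', h', h.symm⟩)

/-- A closed walk with a nonzero moment and as many vertices as possible walks around a tree: it
walks back along its first edge exactly once, and splits there into two walks without common
entries. -/
lemma exists_split (hv : EntryMoments K N mask val) {l : I × Bool} {w : List (I × Bool)}
    {a b : Fin N} {t : List (Fin N)} (h : w.length = t.length)
    (h0 : val (occ (l :: w) a (b :: t)) ≠ 0) (hc : walkEnd b t = a)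
    (hV : w.length + 3 ≤ 2 * (a :: b :: t).toFinset.card) :
    ∃ u v t₁ t₂, w = u ++ (l.1, !l.2) :: v ∧ t = t₁ ++ a :: t₂ ∧ u.length = t₁.length ∧
      v.length = t₂.length ∧ walkEnd b t₁ = b ∧
      (step l a b).1 ∉ (occ u b t₁).map Prod.fst ∧ (step l a b).1 ∉ (occ v a t₂).map Prod.fst ∧
      ∀ o ∈ occ u b t₁, ∀ o' ∈ occ v a t₂, o.1 ≠ o'.1 := by
  set L := (occ (l :: w) a (b :: t)).map Prod.fst with hL
  have hlen : L.length = w.length + 1 := by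
    rw [hL, List.length_map, length_occ (by simp [h])]
    rfl
  have hLc := hv.two_le_count h0
  rw [← hL] at hLc
  have hV1 : (a :: b :: t).toFinset.card ≤ L.toFinset.card + 1 :=
    card_vertices_le_aux (w := l :: w) (by simp [h])
  have hL2 := two_mul_card_toFinset_le hLc
  -- By `hV` both inequalities, vertices against entries and entries against length, are sharp.
  have hc2 : ∀ e ∈ L, L.count e = 2 := fun e he => count_eq_two hLc (by omega) he
  have he0 : (step l a b).1 ∈ L := by simp [hL, occ]
  have hLcons : L = (step l a b).1 :: (occ w b t).map Prod.fst := by simp [hL, occ]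
  have h1 : ((occ w b t).map Prod.fst).count (step l a b).1 = 1 := by
    have := hc2 _ he0
    rw [hLcons, List.count_cons_self] at this
    omega
  obtain ⟨o, ho, hoe⟩ := List.mem_map.1 (List.count_pos_iff.1 (h1.symm ▸ Nat.one_pos))
  obtain ⟨O₁, O₂, hO⟩ := List.append_of_mem ho
  rw [hO, List.map_append, List.map_cons, hoe, List.count_append, List.count_cons_self] at h1
  have hn1 : (step l a b).1 ∉ O₁.map Prod.fst := List.count_eq_zero.1 (by omega)
  have hn2 : (step l a b).1 ∉ O₂.map Prod.fst := List.count_eq_zero.1 (by omega)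
  obtain ⟨u, l₂, v, t₁, c, t₂, rfl, rfl, h3, h4, rfl, rfl, rfl⟩ := exists_split_of_occ_eq h hO
  have hend : walkEnd c t₂ = a := by
    rw [walkEnd_append] at hc
    exact hc
  -- the edges other than the first one
  set E := (L.toFinset.erase (step l a b).1).image edge with hE
  have hEc : E.card + 1 < (a :: b :: (t₁ ++ c :: t₂)).toFinset.card := by
    have h5 : E.card ≤ (L.toFinset.erase (step l a b).1).card := Finset.card_image_le
    rw [Finset.card_erase_of_mem (List.mem_toFinset.2 he0)] at h5
    omega
  have hE1 : ∀ o ∈ occ u b t₁, edge o.1 ∈ E := fun o ho => by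
    refine Finset.mem_image_of_mem _ (Finset.mem_erase.2 ⟨fun h' => hn1 ?_, ?_⟩)
    · rw [← h']; exact List.mem_map_of_mem ho
    · rw [List.mem_toFinset, hLcons, hO]
      exact List.mem_cons_of_mem _ (List.mem_map_of_mem (by simp [ho]))
  have hE2 : ∀ o ∈ occ v c t₂, edge o.1 ∈ E := fun o ho => by
    refine Finset.mem_image_of_mem _ (Finset.mem_erase.2 ⟨fun h' => hn2 ?_, ?_⟩)
    · rw [← h']; exact List.mem_map_of_mem ho
    · rw [List.mem_toFinset, hLcons, hO]
      exact List.mem_cons_of_mem _ (List.mem_map_of_mem (by simp [ho]))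
  -- The first edge is a bridge: without it, the edges left are too few to hold all vertices in one
  -- component. Each degenerate case below is refuted by exhibiting such a component.
  have key : ∀ W : Finset (Fin N), W.card ≤ E.card + 1 → (∀ y ∈ b :: t₁, y ∈ W) →
      (∀ y ∈ c :: t₂, y ∈ W) → False := by
    intro W hWc hW1 hW2
    refine absurd (Finset.card_le_card (s := (a :: b :: (t₁ ++ c :: t₂)).toFinset) (t := W) ?_)
      (by omega)
    intro y hy
    rw [List.mem_toFinset] at hy
    have ha : a ∈ W := hW2 a (hend ▸ walkEnd_mem c t₂)
    simp only [List.mem_cons, List.mem_append] at hy hW1 hW2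
    rcases hy with rfl | rfl | hy | rfl | hy
    · exact ha
    · exact hW1 _ (by simp)
    · exact hW1 _ (by simp [hy])
    · exact hW2 _ (by simp)
    · exact hW2 _ (by simp [hy])
  have hedge : s(walkEnd b t₁, c) = s(a, b) := by
    rw [← edge_step l₂, ← edge_step l, hoe]
  have hdir : walkEnd b t₁ = b ∧ c = a := by
    rcases Sym2.eq_iff.1 hedge with ⟨h5, h6⟩ | ⟨h5, h6⟩
    -- Walking the first edge twice in the same direction would make both partial walks start at
    -- `b`.
    · exfalso
      obtain ⟨W, hb, hWc, hcl⟩ := exists_closed_finset E b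
      exact key W hWc (walk_subset hcl h3 hE1 (by simp) hb)
        (walk_subset hcl h4 hE2 (z := c) (by simp) (by rwa [h6]))
    · exact ⟨h5, h6⟩
  obtain ⟨hend1, rfl⟩ := hdir
  rw [hend1] at hoe
  have hab : c ≠ b := by
    rintro rfl
    obtain ⟨W, hb, hWc, hcl⟩ := exists_closed_finset E c
    exact key W hWc (walk_subset hcl h3 hE1 (by simp) hb)
        (walk_subset hcl h4 hE2 (z := c) (by simp) hb)
  -- Reading the same entry in the opposite direction, with `c ≠ b`, forces the adjoint letter of
  -- the same matrix.
  have hl : l₂ = (l.1, !l.2) := by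
    obtain ⟨p, s⟩ := l
    obtain ⟨p₂, s₂⟩ := l₂
    cases s <;> cases s₂ <;> simp [step, hab, hab.symm] at hoe ⊢ <;> exact hoe
  subst hl
  refine ⟨u, v, t₁, t₂, rfl, rfl, h3, h4, hend1, hn1, hn2, ?_⟩
  intro o ho o' ho' hoo
  obtain ⟨W, hb, hWc, hcl⟩ := exists_closed_finset E b
  have hW1 := walk_subset hcl h3 hE1 (z := b) (by simp) hb
  refine key W hWc hW1 (walk_subset hcl h4 hE2 (z := o'.1.2.1) (mem_of_mem_occ ho').1 ?_)
  rw [← hoo]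
  exact hW1 _ (mem_of_mem_occ ho).1

/-- Two walks with nonzero moments which together visit as many vertices as possible are
disjoint. -/
lemma val_eq_of_val_ne_zero (hv : EntryMoments K N mask val) {l : I × Bool}
    {u v : List (I × Bool)} {a b : Fin N} {t₁ t₂ : List (Fin N)} (h1 : u.length = t₁.length)
    (h2 : v.length = t₂.length) (hu : val (occ u b t₁) ≠ 0) (hw : val (occ v a t₂) ≠ 0)
    (hend : walkEnd b t₁ = b)
    (hV : u.length + v.length + 4 ≤ 2 * (a :: b :: (t₁ ++ a :: t₂)).toFinset.card) :
    val (occ (l :: (u ++ (l.1, !l.2) :: v)) a (b :: (t₁ ++ a :: t₂))) =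
      mask (step l a b).1 / N * (val (occ u b t₁) * val (occ v a t₂)) := by
  have h3 := hv.card_vertices_le h1 hu
  have h4 := hv.card_vertices_le h2 hw
  have h5 : (a :: b :: (t₁ ++ a :: t₂)).toFinset = (b :: t₁).toFinset ∪ (a :: t₂).toFinset := by
    ext y
    simp only [List.mem_toFinset, List.mem_cons, List.mem_append, Finset.mem_union]
    tauto
  have h6 := Finset.card_union_add_card_inter (b :: t₁).toFinset (a :: t₂).toFinset
  rw [← h5] at h6
  -- The bounds `h3` and `h4` add up to exactly the number of vertices required by `hV`, so no
  -- vertex can be shared.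
  have h7 : (b :: t₁).toFinset ∩ (a :: t₂).toFinset = ∅ := Finset.card_eq_zero.1 (by omega)
  have hdis : ∀ y, y ∈ b :: t₁ → y ∈ a :: t₂ → False := fun y hy hy' => by
    have : y ∈ (b :: t₁).toFinset ∩ (a :: t₂).toFinset :=
      Finset.mem_inter.2 ⟨List.mem_toFinset.2 hy, List.mem_toFinset.2 hy'⟩
    rw [h7] at this
    simp at this
  have hmem : (a = (step l a b).1.2.1 ∧ b = (step l a b).1.2.2) ∨
      (b = (step l a b).1.2.1 ∧ a = (step l a b).1.2.2) := by
    obtain ⟨p, s⟩ := l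
    cases s <;> simp [step]
  rw [occ, occ_append h1, hend, occ]
  refine hv.factor ?_ ?_ ?_
  · intro h
    obtain ⟨o, ho, hoe⟩ := List.mem_map.1 h
    have := mem_of_mem_occ ho
    rw [hoe] at this
    rcases hmem with ⟨h8, h9⟩ | ⟨h8, h9⟩
    · exact hdis a (h8 ▸ this.1) (by simp)
    · exact hdis a (h9 ▸ this.2) (by simp)
  · intro h
    obtain ⟨o, ho, hoe⟩ := List.mem_map.1 h
    have := mem_of_mem_occ ho
    rw [hoe] at this
    rcases hmem with ⟨h8, h9⟩ | ⟨h8, h9⟩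
    · exact hdis b (by simp) (h9 ▸ this.2)
    · exact hdis b (by simp) (h8 ▸ this.1)
  · intro o ho o' ho' h
    exact hdis _ (mem_of_mem_occ ho).1 (h ▸ (mem_of_mem_occ ho').1)

end EntryMoments

lemma take_append_cons_drop {β : Type*} {L : List β} {j : ℕ} {x : β} (h : L[j]? = some x) :
    L = L.take j ++ x :: L.drop (j + 1) ∧ (L.take j).length = j := by
  obtain ⟨hj, rfl⟩ := List.getElem?_eq_some_iff.1 h
  refine ⟨?_, by simp; omega⟩
  rw [← List.drop_eq_getElem_cons, List.take_append_drop]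

/-- The contribution to a walk of the way back along its first edge at the time `j`. -/
def splitTerm {I 𝕜 : Type*} [RCLike 𝕜] [DecidableEq I] {N : ℕ} (mask : I × Fin N × Fin N → 𝕜)
    (val : List ((I × Fin N × Fin N) × Bool) → 𝕜) (l : I × Bool) (w : List (I × Bool))
    (a b : Fin N) (t : List (Fin N)) (j : ℕ) : 𝕜 :=
  if w[j]? = some (l.1, !l.2) ∧ t[j]? = some a ∧ walkEnd b (t.take j) = b ∧
      walkEnd a (t.drop (j + 1)) = a then
    mask (step l a b).1 / N * (val (occ (w.take j) b (t.take j)) *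
      val (occ (w.drop (j + 1)) a (t.drop (j + 1))))
  else 0

namespace EntryMoments

variable {I 𝕜 : Type*} [RCLike 𝕜] [DecidableEq I] {K : ℕ → ℝ} {N : ℕ}
  {mask : I × Fin N × Fin N → 𝕜} {val : List ((I × Fin N × Fin N) × Bool) → 𝕜}

/-- For an extremal walk the recursion is exact: a nonzero moment comes from the unique time of
return along the first edge, and conversely a nonzero term would produce a nonzero moment of a
closed walk. -/
lemma eq_sum_splitTerm (hv : EntryMoments K N mask val) {l : I × Bool} {w : List (I × Bool)}
    {a b : Fin N} {t : List (Fin N)} (h : w.length = t.length)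
    (hV : w.length + 3 ≤ 2 * (a :: b :: t).toFinset.card) :
    (if walkEnd b t = a then val (occ (l :: w) a (b :: t)) else 0) =
      ∑ j ∈ Finset.range w.length, splitTerm mask val l w a b t j := by
  by_cases hc : walkEnd b t = a ∧ val (occ (l :: w) a (b :: t)) ≠ 0
  · obtain ⟨u, v, t₁, t₂, rfl, rfl, h1, h2, h3, h4, h5, h6⟩ := hv.exists_split h hc.2 hc.1 hV
    have h7 : walkEnd a t₂ = a := by
      have := hc.1
      rw [walkEnd_append] at this
      exact this
    rw [if_pos hc.1, Finset.sum_eq_single u.length]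
    · rw [splitTerm, if_pos ⟨by simp, by simp [h1], by simp [h1, h3], by simp [h1, h7]⟩]
      have h8 : (u ++ (l.1, !l.2) :: v).drop (u.length + 1) = v := by simp
      have h9 : (t₁ ++ a :: t₂).drop (u.length + 1) = t₂ := by simp [h1]
      have h10 : (t₁ ++ a :: t₂).take u.length = t₁ := by simp [h1]
      rw [occ, occ_append h1, h3, occ, hv.factor h4 h5 h6, h8, h9, h10, List.take_left]
    -- A second return time would put the first entry among the occurrences of one of the two
    -- partial walks, which `h4` and `h5` exclude.
    · intro j hj hju
      rw [splitTerm, if_neg]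
      rintro ⟨hw, ht, hb, -⟩
      obtain ⟨hw1, hw2⟩ := take_append_cons_drop hw
      obtain ⟨ht1, ht2⟩ := take_append_cons_drop ht
      have hO : occ (u ++ (l.1, !l.2) :: v) b (t₁ ++ a :: t₂) =
          occ u b t₁ ++ step (l.1, !l.2) b a :: occ v a t₂ := by
        rw [occ_append h1, h3, occ]
      have hlt : j < (occ (u ++ (l.1, !l.2) :: v) b (t₁ ++ a :: t₂)).length := by
        rw [length_occ h]; exact Finset.mem_range.1 hj
      have hO' : (occ (u ++ (l.1, !l.2) :: v) b (t₁ ++ a :: t₂))[j]? =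
          some (step (l.1, !l.2) b a) := by
        rw [hw1, ht1, occ_append (by rw [hw2, ht2]), hb, occ, List.getElem?_append_right]
        · simp [length_occ, hw2, ht2]
        · rw [length_occ (by rw [hw2, ht2]), hw2]
      have hs : (step (l.1, !l.2) b a).1 = (step l a b).1 := by
        obtain ⟨p, s⟩ := l
        cases s <;> simp [step]
      rw [hO] at hO'
      rcases lt_or_gt_of_ne hju with hlt | hlt
      · rw [List.getElem?_append_left (by rwa [length_occ h1])] at hO'
        exact h4 (hs ▸ List.mem_map_of_mem (List.mem_of_getElem? hO'))
      · rw [List.getElem?_append_right (by rw [length_occ h1]; omega), length_occ h1,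
          show j - u.length = (j - u.length - 1) + 1 by omega, List.getElem?_cons_succ] at hO'
        exact h5 (hs ▸ List.mem_map_of_mem (List.mem_of_getElem? hO'))
    · simp
  · have h0 : (if walkEnd b t = a then val (occ (l :: w) a (b :: t)) else 0) = 0 := by
      rw [ite_eq_right_iff]
      intro h
      by_contra h'
      exact hc ⟨h, h'⟩
    rw [h0]
    refine (Finset.sum_eq_zero fun j hj => ?_).symm
    by_contra hne
    have hcond := (ite_ne_right_iff.1 hne).1
    rw [splitTerm, if_pos hcond] at hne
    obtain ⟨hw, ht, hb, ha⟩ := hcond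
    obtain ⟨hw1, hw2⟩ := take_append_cons_drop hw
    obtain ⟨ht1, ht2⟩ := take_append_cons_drop ht
    have hlen : (w.drop (j + 1)).length = (t.drop (j + 1)).length := by simp [h]
    have hw3 : w.length = j + (w.drop (j + 1)).length + 1 := by
      have := Finset.mem_range.1 hj
      rw [List.length_drop]; omega
    have hv' := hv.val_eq_of_val_ne_zero (l := l) (u := w.take j) (v := w.drop (j + 1)) (a := a)
      (b := b) (t₁ := t.take j) (t₂ := t.drop (j + 1)) (by rw [hw2, ht2]) hlen
      (left_ne_zero_of_mul (right_ne_zero_of_mul hne))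
      (right_ne_zero_of_mul (right_ne_zero_of_mul hne)) hb
      (by rw [← ht1, hw2]; omega)
    rw [← hw1, ← ht1] at hv'
    refine hc ⟨?_, by rw [hv']; exact hne⟩
    rw [ht1, walkEnd_append]
    exact ha

/-- The sum of the contributions of the ways back at the time `j`. -/
lemma sum_splitTerm (l : I × Bool) (w : List (I × Bool)) (a : Fin N) {j : ℕ}
    (hj : j < w.length) :
    ∑ b, ∑ t ∈ listsOfLength (Fin N) w.length, splitTerm mask val l w a b t j =
      if w[j]? = some (l.1, !l.2) then
        (∑ b, mask (step l a b).1 * diagMoment val (w.take j) b) / N *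
          diagMoment val (w.drop (j + 1)) a
      else 0 := by
  split_ifs with hw
  · rw [Finset.sum_div, Finset.sum_mul]
    refine Finset.sum_congr rfl fun b _ => ?_
    have hlen : w.length = j + ((w.length - (j + 1)) + 1) := by omega
    have h1 : (w.take j).length = j := by simp; omega
    rw [hlen, sum_listsOfLength_add, diagMoment, h1, mul_div_right_comm, Finset.mul_sum,
      Finset.sum_mul]
    refine Finset.sum_congr rfl fun t ht => ?_
    obtain rfl := mem_listsOfLength.1 ht
    -- The vertex in position `j` of the walk is where the return arrives, so only `a` survives.
    rw [sum_listsOfLength_succ, Finset.sum_eq_single a]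
    · rw [diagMoment, List.length_drop, Finset.mul_sum]
      refine Finset.sum_congr rfl fun t' _ => ?_
      simp only [splitTerm, hw, List.getElem?_append_right le_rfl, List.take_left, Nat.sub_self,
        List.getElem?_cons_zero, true_and]
      rw [show (t ++ a :: t').drop (t.length + 1) = t' by simp]
      by_cases h2 : walkEnd b t = b <;> by_cases h3 : walkEnd a t' = a <;> simp [h2, h3, mul_assoc]
    · intro c _ hc
      refine Finset.sum_eq_zero fun t' _ => ?_
      rw [splitTerm, if_neg]
      rintro ⟨-, h2, -⟩
      simp [hc] at h2
    · simp
  · refine Finset.sum_eq_zero fun b _ => Finset.sum_eq_zero fun t _ => ?_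
    rw [splitTerm, if_neg]
    tauto

/-- The variance gives two powers of `1 / √N` and the partial walks give the others; the total is
the order of the moment of the whole walk. -/
lemma norm_splitTerm_le (hv : EntryMoments K N mask val) (hN : 0 < N) (hK : ∀ n, 0 ≤ K n)
    (l : I × Bool) (w : List (I × Bool)) (a b : Fin N) {t : List (Fin N)}
    (h : w.length = t.length) (j : ℕ) :
    ‖splitTerm mask val l w a b t j‖ ≤
      K j * K (w.length - (j + 1)) / √N ^ (w.length + 1) := by
  have hr : 0 < √(N : ℝ) := Real.sqrt_pos.2 (by exact_mod_cast hN)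
  rw [splitTerm]
  split_ifs with hc
  · obtain ⟨hw, ht, -⟩ := hc
    have hj : j < w.length := (List.getElem?_eq_some_iff.1 hw).1
    obtain ⟨hw1, hw2⟩ := take_append_cons_drop hw
    obtain ⟨ht1, ht2⟩ := take_append_cons_drop ht
    have hu := hv.bound (occ (w.take j) b (t.take j))
    have hw := hv.bound (occ (w.drop (j + 1)) a (t.drop (j + 1)))
    rw [length_occ (by rw [hw2, ht2]), hw2] at hu
    rw [length_occ (by simp [h]), List.length_drop] at hw
    have hm : ‖mask (step l a b).1 / (N : 𝕜)‖ ≤ 1 / √(N : ℝ) ^ 2 := by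
      rw [norm_div, RCLike.norm_natCast, Real.sq_sqrt (Nat.cast_nonneg N)]
      gcongr
      exact hv.mask_le _
    rw [norm_mul, norm_mul]
    calc _ ≤ 1 / √(N : ℝ) ^ 2 * (K j / √N ^ j *
          (K (w.length - (j + 1)) / √N ^ (w.length - (j + 1)))) := by
          have := hK j
          gcongr
      _ = K j * K (w.length - (j + 1)) / √N ^ (2 + (j + (w.length - (j + 1)))) := by
          rw [pow_add, pow_add]
          field_simp
      _ = _ := by
          congr 2
          omega
  · rw [norm_zero]
    have := hK j
    have := hK (w.length - (j + 1))
    positivity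

/-- The recursion for the contributions of the closed walks to the word `l :: w`. -/
theorem diagMoment_recursion (K : ℕ → ℝ) (hK : ∀ n, 0 ≤ K n) (l : I × Bool)
    (w : List (I × Bool)) :
    ∃ C, ∀ (N : ℕ) (mask : I × Fin N × Fin N → 𝕜)
      (val : List ((I × Fin N × Fin N) × Bool) → 𝕜), EntryMoments K N mask val → ∀ a,
      ‖diagMoment val (l :: w) a - splitSum (l.1, !l.2) (fun u v =>
        (∑ b, mask (step l a b).1 * diagMoment val u b) / N * diagMoment val v a) w‖ ≤ C / √N := by
  set n := w.length with hn
  -- On a walk that is not extremal, the moment and all its split terms are simply bounded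
  -- separately.
  set c := K (n + 1) + ∑ j ∈ Finset.range n, K j * K (n - (j + 1)) with hc
  have hc0 : 0 ≤ c := add_nonneg (hK _) (Finset.sum_nonneg fun j _ => mul_nonneg (hK _) (hK _))
  refine ⟨(n + 2 : ℝ) ^ (n + 1) * c, fun N mask val hv a => ?_⟩
  have hN : 0 < N := a.pos
  have : Nonempty (Fin N) := ⟨a⟩
  have hr1 : 1 ≤ √(N : ℝ) := Real.one_le_sqrt.2 (by exact_mod_cast hN)
  have hsum : splitSum (l.1, !l.2) (fun u v =>
        (∑ b, mask (step l a b).1 * diagMoment val u b) / N * diagMoment val v a) w =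
      ∑ b, ∑ t ∈ listsOfLength (Fin N) n, ∑ j ∈ Finset.range n,
        splitTerm mask val l w a b t j := by
    rw [splitSum]
    simp_rw [Finset.sum_comm (s := listsOfLength (Fin N) n)]
    rw [Finset.sum_comm]
    exact Finset.sum_congr rfl fun j hj => (sum_splitTerm l w a (Finset.mem_range.1 hj)).symm
  have hterm : ∀ b, ∀ t ∈ listsOfLength (Fin N) n,
      ‖(if walkEnd b t = a then val (occ (l :: w) a (b :: t)) else 0) -
        ∑ j ∈ Finset.range n, splitTerm mask val l w a b t j‖ ≤
      if ({a} ∪ (b :: t).toFinset).card ≤ ({a} : Finset (Fin N)).card + n / 2 then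
        c / √N ^ (n + 1) else 0 := by
    intro b t ht
    have ht' : w.length = t.length := (mem_listsOfLength.1 ht).symm
    by_cases hg : ({a} ∪ (b :: t).toFinset).card ≤ ({a} : Finset (Fin N)).card + n / 2
    · rw [if_pos hg]
      refine (norm_sub_le _ _).trans ?_
      rw [hc, add_div, Finset.sum_div]
      refine add_le_add ?_ ((norm_sum_le _ _).trans (Finset.sum_le_sum fun j _ =>
        hv.norm_splitTerm_le hN hK l w a b ht' j))
      have hb := hv.bound (occ (l :: w) a (b :: t))
      rw [length_occ (by simp [ht'])] at hb
      split_ifs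
      · exact hb
      · rw [norm_zero]
        exact div_nonneg (hK _) (by positivity)
    · rw [if_neg hg, hv.eq_sum_splitTerm ht', sub_self, norm_zero]
      have h1 : (a :: b :: t).toFinset = {a} ∪ (b :: t).toFinset := by
        rw [List.toFinset_cons, Finset.insert_eq]
      rw [h1]
      simp only [Finset.card_singleton] at hg
      omega
  -- At most `n / 2` vertices besides `a` leave `O(√N ^ n)` walks, each with an error of order `√N ^
  -- -(n + 1)`; one factor `1 / √N` remains.
  have hcard : (((listsOfLength (Fin N) (n + 1)).filter fun t =>
      ({a} ∪ t.toFinset).card ≤ ({a} : Finset (Fin N)).card + n / 2).card : ℝ) ≤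
      (n + 2 : ℝ) ^ (n + 1) * √N ^ n := by
    have h1 := card_filter_listsOfLength_le (n + 1) (n + 1) (n / 2) ({a} : Finset (Fin N))
      (by simp; omega)
    rw [Fintype.card_fin] at h1
    calc _ ≤ (((n + 1 + 1) ^ (n + 1) * N ^ (n / 2) : ℕ) : ℝ) := by exact_mod_cast h1
      _ = (n + 2 : ℝ) ^ (n + 1) * √N ^ (2 * (n / 2)) := by
          push_cast
          rw [pow_mul, Real.sq_sqrt (Nat.cast_nonneg N)]
          ring
      _ ≤ _ := by
          gcongr
          omega
  rw [hsum, diagMoment, List.length_cons, ← hn, sum_listsOfLength_succ, ← Finset.sum_sub_distrib]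
  simp_rw [← Finset.sum_sub_distrib]
  calc _ ≤ ∑ b, ∑ t ∈ listsOfLength (Fin N) n,
        if ({a} ∪ (b :: t).toFinset).card ≤ ({a} : Finset (Fin N)).card + n / 2 then
          c / √N ^ (n + 1) else 0 :=
        norm_sum_le_of_le _ fun b _ => norm_sum_le_of_le _ fun t ht => hterm b t ht
    _ = (((listsOfLength (Fin N) (n + 1)).filter fun t =>
        ({a} ∪ t.toFinset).card ≤ ({a} : Finset (Fin N)).card + n / 2).card : ℝ) *
          (c / √N ^ (n + 1)) := by
        rw [← nsmul_eq_mul, ← Finset.sum_const, Finset.sum_filter, sum_listsOfLength_succ]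
    _ ≤ (n + 2 : ℝ) ^ (n + 1) * √N ^ n * (c / √N ^ (n + 1)) := by
        gcongr
    _ = _ := by
        rw [pow_succ (√(N : ℝ))]
        field_simp

omit [DecidableEq I] in
lemma diagMoment_nil (hv : EntryMoments K N mask val) (a : Fin N) : diagMoment val [] a = 1 := by
  rw [diagMoment, List.length_nil, listsOfLength, Finset.sum_singleton, walkEnd, if_pos rfl, occ]
  · exact hv.nil
  · simp

/-- The contributions of the closed walks to a word are bounded. -/
theorem exists_norm_diagMoment_le (K : ℕ → ℝ) (hK : ∀ n, 0 ≤ K n) (w : List (I × Bool)) :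
    ∃ C, 0 ≤ C ∧ ∀ (N : ℕ) (mask : I × Fin N × Fin N → 𝕜)
      (val : List ((I × Fin N × Fin N) × Bool) → 𝕜), EntryMoments K N mask val → ∀ a,
      ‖diagMoment val w a‖ ≤ C := by
  induction hn : w.length using Nat.strong_induction_on generalizing w with
  | _ n ih =>
  cases w with
  | nil => exact ⟨1, zero_le_one, fun N mask val hv a => by rw [hv.diagMoment_nil, norm_one]⟩
  | cons l w =>
    obtain ⟨C, hC⟩ := diagMoment_recursion (𝕜 := 𝕜) K hK l w
    choose B hB0 hB using fun (u : {u : List (I × Bool) // u.length < n}) =>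
      ih _ u.2 u.1 rfl
    let B' : List (I × Bool) → ℝ := fun u => if h : u.length < n then B ⟨u, h⟩ else 0
    have hB' : ∀ u : List (I × Bool), 0 ≤ B' u := fun u => by
      simp only [B']; split_ifs; exacts [hB0 _, le_rfl]
    have hb : ∀ u : List (I × Bool), u.length < n → ∀ (N : ℕ) (mask : I × Fin N × Fin N → 𝕜)
      (val : List ((I × Fin N × Fin N) × Bool) → 𝕜), EntryMoments K N mask val → ∀ a,
      ‖diagMoment val u a‖ ≤ B' u := fun u hu N mask val hv a => by
        simp only [B', dif_pos hu]
        exact hB ⟨u, hu⟩ N mask val hv a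
    simp only [List.length_cons] at hn
    refine ⟨|C| + ∑ j ∈ Finset.range w.length, B' (w.take j) * B' (w.drop (j + 1)),
      add_nonneg (abs_nonneg _) (Finset.sum_nonneg fun j _ => mul_nonneg (hB' _) (hB' _)),
      fun N mask val hv a => ?_⟩
    have hN : 0 < N := a.pos
    have hr1 : 1 ≤ √(N : ℝ) := Real.one_le_sqrt.2 (by exact_mod_cast hN)
    have h1 := hC N mask val hv a
    refine (norm_le_norm_sub_add _ _).trans (add_le_add (h1.trans ?_) ?_)
    · calc C / √N ≤ |C| / √N := by gcongr; exact le_abs_self C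
        _ ≤ |C| := div_le_self (abs_nonneg _) hr1
    · refine norm_sum_le_of_le _ fun j hj => ?_
      have hj := Finset.mem_range.1 hj
      split_ifs
      · have hu : (w.take j).length < n := by simp; omega
        have hw : (w.drop (j + 1)).length < n := by simp; omega
        rw [norm_mul, norm_div, RCLike.norm_natCast]
        refine mul_le_mul ?_ (hb _ hw N mask val hv a) (norm_nonneg _) (hB' _)
        rw [div_le_iff₀ (by exact_mod_cast hN)]
        calc _ ≤ ∑ _b : Fin N, B' (w.take j) := norm_sum_le_of_le _ fun b _ => by
              rw [norm_mul]
              calc _ ≤ 1 * B' (w.take j) :=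
                    mul_le_mul (hv.mask_le _) (hb _ hu N mask val hv b) (norm_nonneg _) zero_le_one
                _ = _ := one_mul _
          _ = _ := by simp [mul_comm]
      · rw [norm_zero]
        exact mul_nonneg (hB' _) (hB' _)

end EntryMoments

/-! ### Joint moments of independent entries. -/

section OccProd

variable {𝕜 : Type*} [RCLike 𝕜] {E Ω : Type*}

/-- The product of the occurrences `O` of the entries of `y` and of their conjugates. -/
def occProd (y : E → 𝕜) (O : List (E × Bool)) : 𝕜 :=
  (O.map fun o => if o.2 then star (y o.1) else y o.1).prod

lemma occProd_append (y : E → 𝕜) (O O' : List (E × Bool)) :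
    occProd y (O ++ O') = occProd y O * occProd y O' := by
  simp [occProd]

lemma occProd_cons (y : E → 𝕜) (o : E × Bool) (O : List (E × Bool)) :
    occProd y (o :: O) = (if o.2 then star (y o.1) else y o.1) * occProd y O := by
  simp [occProd]

lemma occProd_congr {y y' : E → 𝕜} {O : List (E × Bool)} (h : ∀ o ∈ O, y o.1 = y' o.1) :
    occProd y O = occProd y' O := by
  unfold occProd
  congr 1
  exact List.map_congr_left fun o ho => by rw [h o ho]

lemma norm_occProd (y : E → 𝕜) (O : List (E × Bool)) :
    ‖occProd y O‖ = (O.map fun o => ‖y o.1‖).prod := by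
  induction O with
  | nil => simp [occProd]
  | cons o O ih =>
    rw [occProd_cons, norm_mul, ih, List.map_cons, List.prod_cons]
    split_ifs <;> simp

lemma measurable_occProd (O : List (E × Bool)) :
    Measurable fun y : E → 𝕜 => occProd y O := by
  induction O with
  | nil => simp [occProd]
  | cons o O ih =>
    simp_rw [occProd_cons]
    refine Measurable.mul ?_ ih
    split_ifs
    · exact continuous_star.measurable.comp (measurable_pi_apply _)
    · exact measurable_pi_apply _

lemma integral_occProd_append [MeasurableSpace Ω] {μ : Measure Ω} {Y : E → Ω → 𝕜}
    (hY : iIndepFun Y μ) (hm : ∀ e, Measurable (Y e)) {O O' : List (E × Bool)}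
    (h : ∀ o ∈ O, ∀ o' ∈ O', o.1 ≠ o'.1) :
    ∫ ω, occProd (fun e => Y e ω) (O ++ O') ∂μ =
      (∫ ω, occProd (fun e => Y e ω) O ∂μ) * ∫ ω, occProd (fun e => Y e ω) O' ∂μ := by
  classical
  let S := (O.map Prod.fst).toFinset
  let S' := (O'.map Prod.fst).toFinset
  have hS : Disjoint S S' := by
    rw [Finset.disjoint_left]
    intro e he he'
    simp only [S, S', List.mem_toFinset, List.mem_map] at he he'
    obtain ⟨o, ho, rfl⟩ := he
    obtain ⟨o', ho', h'⟩ := he'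
    exact h o ho o' ho' h'.symm
  -- Extension by zero exhibits each product as a measurable function of the finitely many entries
  -- occurring in it, as independence of disjoint blocks requires.
  let ext (T : Finset E) (y : T → 𝕜) : E → 𝕜 := fun e => if h : e ∈ T then y ⟨e, h⟩ else 0
  have hext : ∀ T, Measurable (ext T) := fun T => by
    refine measurable_pi_lambda _ fun e => ?_
    by_cases h : e ∈ T
    · simp only [ext, dif_pos h]
      exact measurable_pi_apply _
    · simp only [ext, dif_neg h]
      exact measurable_const
  have key : ∀ (Q : List (E × Bool)) ω, occProd (fun e => Y e ω) Q =
      occProd (ext (Q.map Prod.fst).toFinset fun e => Y e ω) Q := fun Q ω =>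
    occProd_congr fun o ho => by
      have : o.1 ∈ (Q.map Prod.fst).toFinset := List.mem_toFinset.2 (List.mem_map_of_mem ho)
      simp only [ext, dif_pos this]
  have hind := (hY.indepFun_finset S S' hS hm).comp
    ((measurable_occProd O).comp (hext S)) ((measurable_occProd O').comp (hext S'))
  simp_rw [occProd_append]
  rw [IndepFun.integral_fun_mul_eq_mul_integral]
  · convert hind using 1
    · exact funext fun ω => key O ω
    · exact funext fun ω => key O' ω
  · exact ((measurable_occProd O).comp (measurable_pi_lambda _ hm)).aestronglyMeasurable
  · exact ((measurable_occProd O').comp (measurable_pi_lambda _ hm)).aestronglyMeasurable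

/-- The product is at most a power of the largest factor. This bounds mixed moments by moments of
single entries without Hölder's inequality; the `1` covers the empty list. -/
lemma prod_le_one_add_sum_pow (L : List ℝ) (h : ∀ x ∈ L, 0 ≤ x) :
    L.prod ≤ 1 + (L.map fun x => x ^ L.length).sum := by
  rcases L.eq_nil_or_concat with rfl | hne
  · simp
  have hne : L ≠ [] := by
    rintro rfl
    obtain ⟨_, _, h⟩ := hne
    simp at h
  obtain ⟨m, hm, hmax⟩ := L.toFinset.exists_max_image id ⟨L.head hne, by simp⟩
  simp only [List.mem_toFinset, id] at hm hmax
  have h1 : L.prod ≤ m ^ L.length := by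
    have : ∀ L' : List ℝ, (∀ x ∈ L', 0 ≤ x ∧ x ≤ m) → L'.prod ≤ m ^ L'.length := by
      intro L' hL'
      induction L' with
      | nil => simp
      | cons x L' ih =>
        simp only [List.mem_cons, forall_eq_or_imp] at hL'
        rw [List.prod_cons, List.length_cons, pow_succ']
        exact mul_le_mul hL'.1.2 (ih hL'.2) (List.prod_nonneg fun x hx => (hL'.2 x hx).1)
          (h m hm)
    exact this L fun x hx => ⟨h x hx, hmax x hx⟩
  have h2 : m ^ L.length ≤ (L.map fun x => x ^ L.length).sum :=
    List.single_le_sum (by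
      simp only [List.mem_map]
      rintro _ ⟨x, hx, rfl⟩
      exact pow_nonneg (h x hx) _) _ (List.mem_map.2 ⟨m, hm, rfl⟩)
  linarith

end OccProd

/-! ### Entries and words of patterned matrices. -/

section Entries

variable {𝕜 : Type*} [RCLike 𝕜] {Ω I : Type*}

/-- The entries of a family of patterned matrices. -/
def entry (S : I → Set (ℝ × ℝ)) (ξ : I → ℕ → ℕ → Ω → 𝕜) (N : ℕ) (e : I × Fin N × Fin N) (ω : Ω) :
    𝕜 :=
  patternedMatrix N (S e.1) (ξ e.1) ω e.2.1 e.2.2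

open Classical in
/-- The indicator of the filled entries. -/
def fillMask (𝕜 : Type*) [RCLike 𝕜] (S : I → Set (ℝ × ℝ)) (N : ℕ) (e : I × Fin N × Fin N) : 𝕜 :=
  if (interior (gridBox N e.2.2 (N - (e.2.1 + 1)) ∩ S e.1)).Nonempty then 1 else 0

lemma entry_eq (S : I → Set (ℝ × ℝ)) (ξ : I → ℕ → ℕ → Ω → 𝕜) (N : ℕ) (e : I × Fin N × Fin N)
    (ω : Ω) :
    entry S ξ N e ω = fillMask 𝕜 S N e * (ξ e.1 e.2.1 e.2.2 ω / ((√N : ℝ) : 𝕜)) := by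
  simp [entry, patternedMatrix, fillMask]

lemma norm_fillMask_le (S : I → Set (ℝ × ℝ)) (N : ℕ) (e : I × Fin N × Fin N) :
    ‖fillMask 𝕜 S N e‖ ≤ 1 := by
  unfold fillMask
  split_ifs <;> simp

lemma norm_entry_le (S : I → Set (ℝ × ℝ)) (ξ : I → ℕ → ℕ → Ω → 𝕜) (N : ℕ)
    (e : I × Fin N × Fin N) (ω : Ω) :
    ‖entry S ξ N e ω‖ ≤ ‖ξ e.1 e.2.1 e.2.2 ω‖ / √N := by
  rw [entry_eq, norm_mul, norm_div, RCLike.norm_ofReal, abs_of_nonneg (Real.sqrt_nonneg _)]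
  exact mul_le_of_le_one_left (by positivity) (norm_fillMask_le S N e)

lemma norm_occProd_entry_le (S : I → Set (ℝ × ℝ)) (ξ : I → ℕ → ℕ → Ω → 𝕜) {N : ℕ}
    (O : List ((I × Fin N × Fin N) × Bool)) (ω : Ω) :
    ‖occProd (fun e => entry S ξ N e ω) O‖ ≤
      (1 + (O.map fun o => ‖ξ o.1.1 o.1.2.1 o.1.2.2 ω‖ ^ O.length).sum) / √N ^ O.length := by
  rw [norm_occProd]
  have h1 : (O.map fun o => ‖entry S ξ N o.1 ω‖).prod ≤
      (O.map fun o => ‖ξ o.1.1 o.1.2.1 o.1.2.2 ω‖).prod / √N ^ O.length := by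
    induction O with
    | nil => simp
    | cons o O ih =>
      simp only [List.map_cons, List.prod_cons, List.length_cons]
      rw [pow_succ', mul_div_mul_comm]
      exact mul_le_mul (norm_entry_le S ξ N o.1 ω) ih
        (List.prod_nonneg (by simp only [List.mem_map]; rintro _ ⟨o, -, rfl⟩; positivity))
        (by positivity)
  refine h1.trans ?_
  gcongr
  have := prod_le_one_add_sum_pow (O.map fun o => ‖ξ o.1.1 o.1.2.1 o.1.2.2 ω‖) (by
    simp only [List.mem_map]; rintro _ ⟨o, -, rfl⟩; positivity)
  simpa [List.map_map, Function.comp_def] using this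

variable [MeasurableSpace Ω] {μ : Measure Ω} {S : I → Set (ℝ × ℝ)} {ξ : I → ℕ → ℕ → Ω → 𝕜}

lemma measurable_entry (hξ : ∀ p, IsEntryArray μ (ξ p)) (N : ℕ) (e : I × Fin N × Fin N) :
    Measurable (entry S ξ N e) := by
  have : entry S ξ N e = fun ω => fillMask 𝕜 S N e * (ξ e.1 e.2.1 e.2.2 ω / ((√N : ℝ) : 𝕜)) :=
    funext fun ω => entry_eq S ξ N e ω
  rw [this]
  exact (((hξ e.1).measurable _ _).div_const _).const_mul _

/-- All entries of the family of matrices are independent. -/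
lemma iIndepFun_entry (hξ : ∀ p, IsEntryArray μ (ξ p)) {N : ℕ}
    (hindep : iIndepFun
      (fun p ω (ij : Fin N × Fin N) => patternedMatrix N (S p) (ξ p) ω ij.1 ij.2) μ) :
    iIndepFun (entry S ξ N) μ := by
  -- Independence between the matrices is combined with independence inside each array.
  refine iIndepFun_uncurry' (X := fun p ij => entry S ξ N (p, ij))
    (fun p ij => measurable_entry hξ N (p, ij)) hindep fun p => ?_
  have h1 := (hξ p).indep.precomp (g := fun ij : Fin N × Fin N => ((ij.1 : ℕ), (ij.2 : ℕ)))
    (by rintro ⟨i, j⟩ ⟨i', j'⟩ h; simpa [Fin.ext_iff] using h)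
  have h2 := h1.comp (fun ij x => fillMask 𝕜 S N (p, ij) * (x / ((√N : ℝ) : 𝕜)))
    (fun ij => (measurable_id.div_const _).const_mul _)
  convert h2 using 2 with ij
  exact funext fun ω => entry_eq S ξ N (p, ij) ω

variable [Fintype I]

/-- The bounds for the moments of the entries. -/
def momentBound (μ : Measure Ω) (ξ : I → ℕ → ℕ → Ω → 𝕜) (n : ℕ) : ℝ :=
  1 + n * ∑ p, ∫ ω, ‖ξ p 0 0 ω‖ ^ n ∂μ

lemma momentBound_nonneg (μ : Measure Ω) (ξ : I → ℕ → ℕ → Ω → 𝕜) (n : ℕ) :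
    0 ≤ momentBound μ ξ n := by
  unfold momentBound
  have : 0 ≤ ∑ p, ∫ ω, ‖ξ p 0 0 ω‖ ^ n ∂μ :=
    Finset.sum_nonneg fun p _ => integral_nonneg fun ω => by positivity
  positivity

variable [IsProbabilityMeasure μ]

omit [Fintype I] in
lemma integrable_norm_pow (hξ : ∀ p, IsEntryArray μ (ξ p)) (p : I) (i j n : ℕ) :
    Integrable (fun ω => ‖ξ p i j ω‖ ^ n) μ :=
  ((hξ p).memLp i j n).integrable_norm_pow'

lemma integrable_sum_pow (hξ : ∀ p, IsEntryArray μ (ξ p)) {N : ℕ}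
    (O : List ((I × Fin N × Fin N) × Bool)) (n : ℕ) :
    Integrable (fun ω => (O.map fun o => ‖ξ o.1.1 o.1.2.1 o.1.2.2 ω‖ ^ n).sum) μ ∧
      ∫ ω, (O.map fun o => ‖ξ o.1.1 o.1.2.1 o.1.2.2 ω‖ ^ n).sum ∂μ ≤
        O.length * ∑ p, ∫ ω, ‖ξ p 0 0 ω‖ ^ n ∂μ := by
  induction O with
  | nil => simp
  | cons o O ih =>
    have hi := integrable_norm_pow hξ o.1.1 o.1.2.1 o.1.2.2 n
    simp only [List.map_cons, List.sum_cons, List.length_cons]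
    refine ⟨hi.add ih.1, ?_⟩
    rw [integral_add hi ih.1]
    have h1 : ∫ ω, ‖ξ o.1.1 o.1.2.1 o.1.2.2 ω‖ ^ n ∂μ = ∫ ω, ‖ξ o.1.1 0 0 ω‖ ^ n ∂μ :=
      (((hξ o.1.1).identDistrib _ _ 0 0).comp (u := fun x : 𝕜 => ‖x‖ ^ n)
        (by fun_prop)).integral_eq
    have h2 : ∫ ω, ‖ξ o.1.1 0 0 ω‖ ^ n ∂μ ≤ ∑ p, ∫ ω, ‖ξ p 0 0 ω‖ ^ n ∂μ :=
      Finset.single_le_sum (f := fun p => ∫ ω, ‖ξ p 0 0 ω‖ ^ n ∂μ)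
        (fun p _ => integral_nonneg fun ω => by positivity) (Finset.mem_univ o.1.1)
    rw [h1]
    push_cast
    linarith [ih.2]

lemma integrable_occProd_entry (hξ : ∀ p, IsEntryArray μ (ξ p)) {N : ℕ}
    (O : List ((I × Fin N × Fin N) × Bool)) :
    Integrable (fun ω => occProd (fun e => entry S ξ N e ω) O) μ := by
  refine Integrable.mono' (((integrable_const (1 : ℝ)).add
    (integrable_sum_pow hξ O O.length).1).div_const (√N ^ O.length)) ?_
    (ae_of_all _ fun ω => norm_occProd_entry_le S ξ O ω)
  exact ((measurable_occProd O).comp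
    (measurable_pi_lambda _ (measurable_entry hξ N))).aestronglyMeasurable

/-- The joint moments of the entries of independent patterned matrices. -/
theorem entryMoments (hξ : ∀ p, IsEntryArray μ (ξ p)) {N : ℕ}
    (hindep : iIndepFun
      (fun p ω (ij : Fin N × Fin N) => patternedMatrix N (S p) (ξ p) ω ij.1 ij.2) μ) :
    EntryMoments (momentBound μ ξ) N (fillMask 𝕜 S N)
      (fun O => ∫ ω, occProd (fun e => entry S ξ N e ω) O ∂μ) where
  perm h := integral_congr_ae (ae_of_all _ fun ω => (h.map _).prod_eq)
  disjoint h := integral_occProd_append (iIndepFun_entry hξ hindep) (measurable_entry hξ N) h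
  nil := by simp [occProd]
  single e s := by
    have h0 : ∫ ω, entry S ξ N e ω ∂μ = 0 := by
      simp_rw [entry_eq]
      rw [integral_const_mul, integral_div, (hξ e.1).mean, zero_div, mul_zero]
    cases s
    · simpa [occProd] using h0
    · simp only [occProd, List.map_cons, List.map_nil, List.prod_cons, List.prod_nil, mul_one,
        if_true]
      simp_rw [RCLike.star_def]
      rw [integral_conj, h0, map_zero]
  -- Only an entry against its own conjugate is needed, because extremal walks use every edge once
  -- in each direction. The mean of the square of a complex entry is left free by the hypotheses and
  -- never enters.
  pair e s := by
    have h1 : ∀ ω, occProd (fun e => entry S ξ N e ω) [(e, s), (e, !s)] =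
        fillMask 𝕜 S N e / N * ((‖ξ e.1 e.2.1 e.2.2 ω‖ ^ 2 : ℝ) : 𝕜) := by
      intro ω
      have h2 : occProd (fun e => entry S ξ N e ω) [(e, s), (e, !s)] =
          entry S ξ N e ω * star (entry S ξ N e ω) := by
        cases s <;> simp [occProd, mul_comm]
      have h3 : star (fillMask 𝕜 S N e) = fillMask 𝕜 S N e ∧
          fillMask 𝕜 S N e * fillMask 𝕜 S N e = fillMask 𝕜 S N e := by
        unfold fillMask
        split_ifs <;> simp
      have h4 : (((√N : ℝ) : 𝕜)) * ((√N : ℝ) : 𝕜) = N := by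
        rw [← RCLike.ofReal_mul, Real.mul_self_sqrt (Nat.cast_nonneg N), RCLike.ofReal_natCast]
      rw [h2, entry_eq, star_mul', star_div₀, h3.1, RCLike.star_def, RCLike.conj_ofReal,
        RCLike.ofReal_pow, ← RCLike.mul_conj]
      conv_rhs => rw [← h3.2, ← h4]
      simp only [div_eq_mul_inv, mul_inv]
      ring
    simp_rw [h1]
    rw [integral_const_mul, integral_ofReal, (hξ e.1).variance, RCLike.ofReal_one, mul_one]
  mask_le := norm_fillMask_le S N
  bound O := by
    obtain ⟨h1, h2⟩ := integrable_sum_pow hξ O O.length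
    refine (norm_integral_le_of_norm_le (((integrable_const (1 : ℝ)).add h1).div_const
      (√N ^ O.length)) (ae_of_all _ fun ω => norm_occProd_entry_le S ξ O ω)).trans ?_
    have h3 : ∫ ω, (1 + (O.map fun o => ‖ξ o.1.1 o.1.2.1 o.1.2.2 ω‖ ^ O.length).sum) ∂μ ≤
        momentBound μ ξ O.length := by
      rw [integral_add (integrable_const _) h1, momentBound]
      simpa using h2
    calc _ = (∫ ω, (1 + (O.map fun o => ‖ξ o.1.1 o.1.2.1 o.1.2.2 ω‖ ^ O.length).sum) ∂μ) /
          √N ^ O.length := integral_div _ _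
      _ ≤ _ := by gcongr

/-- The product of the matrices prescribed by a word. -/
def wordProd {N : ℕ} (A : I → Matrix (Fin N) (Fin N) 𝕜) (w : List (I × Bool)) :
    Matrix (Fin N) (Fin N) 𝕜 :=
  (w.map fun l => starLetter (A l.1) l.2).prod

omit [Fintype I] in
-- Expanding the matrix product introduces the walks.
lemma wordProd_apply {N : ℕ} (A : I → Matrix (Fin N) (Fin N) 𝕜) (w : List (I × Bool))
    (a b : Fin N) :
    wordProd A w a b = ∑ t ∈ listsOfLength (Fin N) w.length,
      if walkEnd a t = b then occProd (fun e => A e.1 e.2.1 e.2.2) (occ w a t) else 0 := by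
  induction w generalizing a with
  | nil =>
    rw [List.length_nil, listsOfLength, Finset.sum_singleton, walkEnd]
    simp [wordProd, occ, occProd, Matrix.one_apply]
  | cons l w ih =>
    rw [List.length_cons, sum_listsOfLength_succ]
    have h1 : wordProd A (l :: w) a b = ∑ c, starLetter (A l.1) l.2 a c * wordProd A w c b := by
      simp [wordProd, Matrix.mul_apply]
    rw [h1]
    refine Finset.sum_congr rfl fun c _ => ?_
    rw [ih, Finset.mul_sum]
    refine Finset.sum_congr rfl fun t _ => ?_
    rw [walkEnd, occ, occProd_cons, mul_ite, mul_zero]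
    congr 2
    obtain ⟨p, s⟩ := l
    cases s <;> simp [step, starLetter]

lemma integrable_wordProd (hξ : ∀ p, IsEntryArray μ (ξ p)) (N : ℕ) (w : List (I × Bool))
    (a b : Fin N) :
    Integrable (fun ω => wordProd (fun p => patternedMatrix N (S p) (ξ p) ω) w a b) μ := by
  simp_rw [wordProd_apply]
  refine integrable_finsetSum _ fun t _ => ?_
  split_ifs
  · exact integrable_occProd_entry hξ _
  · exact integrable_zero _ _ _

lemma integral_wordProd (hξ : ∀ p, IsEntryArray μ (ξ p)) (N : ℕ) (w : List (I × Bool))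
    (a : Fin N) :
    ∫ ω, wordProd (fun p => patternedMatrix N (S p) (ξ p) ω) w a a ∂μ =
      diagMoment (fun O => ∫ ω, occProd (fun e => entry S ξ N e ω) O ∂μ) w a := by
  simp_rw [wordProd_apply]
  rw [integral_finsetSum, diagMoment]
  · refine Finset.sum_congr rfl fun t _ => ?_
    split_ifs
    · rfl
    · exact integral_zero _ _
  · intro t _
    split_ifs
    · exact integrable_occProd_entry hξ _
    · exact integrable_zero _ _ _

lemma expTr_wordProd (hξ : ∀ p, IsEntryArray μ (ξ p)) (N : ℕ) (w : List (I × Bool)) :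
    expTr μ (fun ω => wordProd (fun p => patternedMatrix N (S p) (ξ p) ω) w) =
      (N : 𝕜)⁻¹ * ∑ a, diagMoment (fun O => ∫ ω, occProd (fun e => entry S ξ N e ω) O ∂μ) w a := by
  rw [expTr, integral_const_mul]
  simp only [Matrix.trace, Matrix.diag_apply]
  rw [integral_finsetSum _ fun a _ => integrable_wordProd hξ N w a a]
  simp_rw [integral_wordProd hξ]

end Entries

/-! ### Vectors as step functions, averages as integrals. -/

/-- Lebesgue measure on the unit interval. -/
def unitMeasure : Measure ℝ := volume.restrict (Set.Ico 0 1)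

instance : IsProbabilityMeasure unitMeasure :=
  ⟨by simp [unitMeasure]⟩

/-- The step function on the unit interval with the values `g` on the cells of length `1 / N`. -/
def stepFun {M : Type*} [Zero M] (N : ℕ) (g : Fin N → M) (x : ℝ) : M :=
  if h : ⌊x * N⌋₊ < N then g ⟨⌊x * N⌋₊, h⟩ else 0

section StepFun

variable {𝕜 : Type*} [RCLike 𝕜]

variable (𝕜) in
lemma exists_cell {N : ℕ} (hN : 0 < N) {x : ℝ} (hx : x ∈ Set.Ico (0 : ℝ) 1) :
    ∃ a : Fin N, (a : ℝ) / N ≤ x ∧ x < ((a : ℝ) + 1) / N ∧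
      ∀ g : Fin N → 𝕜, stepFun N g x = g a := by
  have hN' : (0 : ℝ) < N := by exact_mod_cast hN
  have h : ⌊x * N⌋₊ < N := by
    rw [Nat.floor_lt (by have := hx.1; positivity)]
    nlinarith [hx.2]
  refine ⟨⟨⌊x * N⌋₊, h⟩, ?_, ?_, fun g => dif_pos h⟩
  · rw [div_le_iff₀ hN']
    exact Nat.floor_le (by have := hx.1; positivity)
  · rw [lt_div_iff₀ hN']
    exact Nat.lt_floor_add_one _

lemma stepFun_eq_sum {N : ℕ} (g : Fin N → 𝕜) {x : ℝ} (hx : x ∈ Set.Ico (0 : ℝ) 1) :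
    stepFun N g x =
      ∑ a : Fin N, (Set.Ico ((a : ℝ) / N) (((a : ℝ) + 1) / N)).indicator (fun _ => g a) x := by
  rcases Nat.eq_zero_or_pos N with rfl | hN
  · simp [stepFun]
  have hN' : (0 : ℝ) < N := by exact_mod_cast hN
  have h : ⌊x * N⌋₊ < N := by
    rw [Nat.floor_lt (by have := hx.1; positivity)]
    nlinarith [hx.2]
  rw [stepFun, dif_pos h, Finset.sum_eq_single ⟨⌊x * N⌋₊, h⟩]
  · rw [Set.indicator_of_mem]
    refine ⟨?_, ?_⟩
    · rw [div_le_iff₀ hN']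
      exact Nat.floor_le (by have := hx.1; positivity)
    · rw [lt_div_iff₀ hN']
      exact Nat.lt_floor_add_one _
  · intro a _ ha
    rw [Set.indicator_of_notMem]
    rintro ⟨h1, h2⟩
    rw [div_le_iff₀ hN'] at h1
    rw [lt_div_iff₀ hN'] at h2
    exact ha (Fin.ext ((Nat.floor_eq_iff (h1.trans' (by positivity))).2 ⟨h1, h2⟩).symm)
  · simp

lemma integral_stepFun (N : ℕ) (g : Fin N → 𝕜) :
    ∫ x, stepFun N g x ∂unitMeasure = (∑ a, g a) / N := by
  rcases Nat.eq_zero_or_pos N with rfl | hN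
  · simp [stepFun]
  have hN' : (0 : ℝ) < N := by exact_mod_cast hN
  rw [unitMeasure, setIntegral_congr_fun measurableSet_Ico fun x hx => stepFun_eq_sum g hx,
    integral_finsetSum, Finset.sum_div]
  · refine Finset.sum_congr rfl fun a _ => ?_
    rw [integral_indicator_const _ measurableSet_Ico, measureReal_restrict_apply measurableSet_Ico,
      Set.inter_eq_left.2]
    · have h1 : ((a : ℝ) + 1) / N - (a : ℝ) / N = 1 / N := by ring
      rw [measureReal_def, Real.volume_Ico, h1, ENNReal.toReal_ofReal (by positivity),
        RCLike.real_smul_eq_coe_mul]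
      push_cast
      ring
    · refine Set.Ico_subset_Ico (by positivity) ?_
      rw [div_le_one hN']
      exact_mod_cast a.2
  · exact fun a _ => (integrable_const _).indicator measurableSet_Ico

lemma measurable_stepFun (N : ℕ) (g : Fin N → 𝕜) : Measurable (stepFun N g) := by
  have : stepFun N g = (fun k : ℕ => if h : k < N then g ⟨k, h⟩ else 0) ∘
      fun x : ℝ => ⌊x * N⌋₊ := rfl
  rw [this]
  exact (measurable_from_nat (f := fun k : ℕ => if h : k < N then g ⟨k, h⟩ else 0)).comp
    (Nat.measurable_floor.comp (by fun_prop))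

lemma norm_stepFun_le {N : ℕ} {g : Fin N → 𝕜} {C : ℝ} (hC : 0 ≤ C) (h : ∀ a, ‖g a‖ ≤ C) (x : ℝ) :
    ‖stepFun N g x‖ ≤ C := by
  unfold stepFun
  split_ifs
  · exact h _
  · rwa [norm_zero]

/-- Dominated convergence for a sequence which converges almost everywhere to some limit. -/
lemma exists_tendsto_integral {F : ℕ → ℝ → 𝕜} (hF : ∀ n, Measurable (F n)) {C : ℝ}
    (hC : ∀ n x, ‖F n x‖ ≤ C)
    (h : ∀ᵐ x ∂unitMeasure, ∃ L, Tendsto (fun n => F n x) atTop (𝓝 L)) :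
    ∃ L, Tendsto (fun n => ∫ x, F n x ∂unitMeasure) atTop (𝓝 L) := by
  classical
  refine ⟨_, tendsto_integral_of_dominated_convergence
    (f := fun x => limUnder atTop fun n => F n x) (fun _ => C)
    (fun n => (hF n).aestronglyMeasurable) (integrable_const C)
    (fun n => ae_of_all _ (hC n)) ?_⟩
  filter_upwards [h] with x hx
  exact tendsto_nhds_limUnder hx

end StepFun

/-! ### Almost everywhere convergence of the masks. -/

section Mask

variable {𝕜 : Type*} [RCLike 𝕜] {I : Type*}

lemma gridBox_nonempty {N : ℕ} (hN : 0 < N) (a b : ℕ) : (gridBox N a b).Nonempty := by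
  have hN' : (0 : ℝ) < N := by exact_mod_cast hN
  refine Set.Nonempty.prod ?_ ?_ <;>
  · rw [Set.nonempty_Ioo]
    gcongr
    linarith

lemma isOpen_gridBox (N a b : ℕ) : IsOpen (gridBox N a b) := isOpen_Ioo.prod isOpen_Ioo

lemma fillMask_eq_one {S : I → Set (ℝ × ℝ)} {N : ℕ} {e : I × Fin N × Fin N}
    (h : gridBox N e.2.2 (N - (e.2.1 + 1)) ⊆ S e.1) : fillMask 𝕜 S N e = 1 := by
  rw [fillMask, if_pos]
  rw [Set.inter_eq_left.2 h, (isOpen_gridBox _ _ _).interior_eq]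
  exact gridBox_nonempty e.2.1.pos _ _

lemma fillMask_eq_zero {S : I → Set (ℝ × ℝ)} {N : ℕ} {e : I × Fin N × Fin N}
    (h : gridBox N e.2.2 (N - (e.2.1 + 1)) ⊆ (S e.1)ᶜ) : fillMask 𝕜 S N e = 0 := by
  rw [fillMask, if_neg]
  rw [Set.disjoint_iff_inter_eq_empty.1 (Set.subset_compl_iff_disjoint_right.1 h)]
  simp

lemma fillMask_unitSquare {S : I → Set (ℝ × ℝ)} {N : ℕ} {e : I × Fin N × Fin N}
    (h : S e.1 = unitSquare) : fillMask 𝕜 S N e = 1 := by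
  apply fillMask_eq_one
  rw [h]
  have hN' : (0 : ℝ) < N := by exact_mod_cast e.2.1.pos
  have key : ∀ a : ℕ, a < N →
      Set.Ioo ((a : ℝ) / N) (((a : ℝ) + 1) / N) ⊆ Set.Icc 0 1 := by
    intro a ha x hx
    refine ⟨le_trans (by positivity) hx.1.le, hx.2.le.trans ?_⟩
    rw [div_le_one hN']
    exact_mod_cast ha
  exact Set.prod_mono (key _ e.2.2.2) (key _ (by have := e.2.1.2; omega))

/-- Rows are drawn from the top, so the row at `x` and the column at `y` meet at the point `(y, 1 -
x)`. -/
lemma gridBox_subset_ball {N : ℕ} {a b : Fin N} {x y ε : ℝ} (hε : 1 / (N : ℝ) < ε)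
    (hx : (a : ℝ) / N ≤ x ∧ x < ((a : ℝ) + 1) / N) (hy : (b : ℝ) / N ≤ y ∧ y < ((b : ℝ) + 1) / N) :
    gridBox N b (N - (a + 1)) ⊆ Metric.ball (y, 1 - x) ε := by
  have hN' : (0 : ℝ) < N := by exact_mod_cast a.pos
  rintro ⟨s, t⟩ ⟨hs, ht⟩
  have h1 : ((N - ((a : ℕ) + 1) : ℕ) : ℝ) = N - (a + 1) := by
    rw [Nat.cast_sub a.2]; push_cast; ring
  simp only [Set.mem_Ioo, h1, sub_div, add_div, div_self hN'.ne'] at hs ht hx hy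
  rw [Metric.mem_ball, Prod.dist_eq, max_lt_iff, Real.dist_eq, Real.dist_eq, abs_lt, abs_lt]
  refine ⟨⟨?_, ?_⟩, ?_, ?_⟩ <;> dsimp only <;> linarith

/-- Off the frontier a point is interior to the pattern or to its complement, and all sufficiently
small cells around it lie on that same side. -/
lemma exists_tendsto_fillMask {S : I → Set (ℝ × ℝ)} {p : I} {x y : ℝ}
    (hx : x ∈ Set.Ico (0 : ℝ) 1) (hy : y ∈ Set.Ico (0 : ℝ) 1) (h : (y, 1 - x) ∉ frontier (S p)) :
    ∃ L, Tendsto (fun N => stepFun N (fun a => stepFun N (fun b => fillMask 𝕜 S N (p, a, b)) y) x)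
      atTop (𝓝 L) := by
  have key : ∀ U : Set (ℝ × ℝ), (y, 1 - x) ∈ interior U → ∀ᶠ N : ℕ in atTop,
      ∃ a b : Fin N, gridBox N b (N - (a + 1)) ⊆ U ∧
        stepFun N (fun a => stepFun N (fun b => fillMask 𝕜 S N (p, a, b)) y) x =
          fillMask 𝕜 S N (p, a, b) := by
    intro U hU
    obtain ⟨ε, hε, hball⟩ := Metric.isOpen_iff.1 isOpen_interior _ hU
    filter_upwards [eventually_gt_atTop 0,
      tendsto_one_div_atTop_nhds_zero_nat.eventually_lt_const hε] with N hN hNε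
    obtain ⟨a, ha1, ha2, ha⟩ := exists_cell 𝕜 hN hx
    obtain ⟨b, hb1, hb2, hb⟩ := exists_cell 𝕜 hN hy
    refine ⟨a, b, ((gridBox_subset_ball hNε ⟨ha1, ha2⟩ ⟨hb1, hb2⟩).trans hball).trans
      interior_subset, ?_⟩
    rw [ha, hb]
  by_cases h1 : (y, 1 - x) ∈ interior (S p)
  · refine ⟨1, tendsto_const_nhds.congr' ?_⟩
    filter_upwards [key _ h1] with N hN
    obtain ⟨a, b, hab, he⟩ := hN
    rw [he, fillMask_eq_one (e := (p, a, b)) hab]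
  · have h2 : (y, 1 - x) ∈ interior (S p)ᶜ := by
      rw [frontier, Set.mem_sdiff, not_and_not_right] at h
      rw [interior_compl, Set.mem_compl_iff]
      exact fun h3 => h1 (h h3)
    refine ⟨0, tendsto_const_nhds.congr' ?_⟩
    filter_upwards [key _ h2] with N hN
    obtain ⟨a, b, hab, he⟩ := hN
    rw [he, fillMask_eq_zero (e := (p, a, b)) hab]

lemma ae_exists_tendsto_fillMask {S : I → Set (ℝ × ℝ)} {p : I} (hS : IsPattern (S p)) :
    ∀ᵐ z ∂(unitMeasure.prod unitMeasure), ∃ L, Tendsto (fun N =>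
      stepFun N (fun a => stepFun N (fun b => fillMask 𝕜 S N (p, a, b)) z.2) z.1) atTop (𝓝 L) := by
  -- Passing from matrix to picture coordinates preserves null sets, in particular that of the
  -- frontier.
  have h1 : MeasurePreserving (fun z : ℝ × ℝ => (z.2, 1 - z.1)) volume volume := by
    have h2 := ((MeasurePreserving.id (volume : Measure ℝ)).prod
      (Measure.measurePreserving_sub_left (volume : Measure ℝ) (1 : ℝ))).comp
      (Measure.measurePreserving_swap (μ := (volume : Measure ℝ)) (ν := (volume : Measure ℝ)))
    exact h2
  have h3 : ∀ᵐ z : ℝ × ℝ, (z.2, 1 - z.1) ∉ frontier (S p) :=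
    h1.quasiMeasurePreserving.ae (measure_eq_zero_iff_ae_notMem.1 hS.frontier_null)
  rw [unitMeasure, Measure.prod_restrict]
  rw [ae_restrict_iff' (measurableSet_Ico.prod measurableSet_Ico)]
  filter_upwards [h3] with z hz hmem
  exact exists_tendsto_fillMask hmem.1 hmem.2 hz

/-- The filled entries read by a letter converge almost everywhere. -/
lemma ae_ae_exists_tendsto_fillMask {S : I → Set (ℝ × ℝ)} (l : I × Bool) (hS : IsPattern (S l.1)) :
    ∀ᵐ x ∂unitMeasure, ∀ᵐ y ∂unitMeasure, ∃ L, Tendsto (fun N =>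
      stepFun N (fun a => stepFun N (fun b => fillMask 𝕜 S N (step l a b).1) y) x)
        atTop (𝓝 L) := by
  obtain ⟨p, s⟩ := l
  refine Measure.ae_ae_of_ae_prod (p := fun z => ∃ L, Tendsto (fun N =>
    stepFun N (fun a => stepFun N (fun b => fillMask 𝕜 S N (step (p, s) a b).1) z.2) z.1)
      atTop (𝓝 L)) ?_
  have h := ae_exists_tendsto_fillMask (𝕜 := 𝕜) hS
  cases s
  · exact h
  · have h' := (Measure.measurePreserving_swap (μ := unitMeasure)
      (ν := unitMeasure)).quasiMeasurePreserving.ae h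
    filter_upwards [h'] with z hz
    obtain ⟨L, hL⟩ := hz
    refine ⟨L, hL.congr fun N => ?_⟩
    simp only [stepFun, step, Prod.fst_swap, Prod.snd_swap]
    split_ifs <;> rfl

end Mask

/-! ### Limits of moments and the Schwinger-Dyson equation. -/

lemma tendsto_const_div_sqrt (C : ℝ) : Tendsto (fun N : ℕ => C / √(N : ℝ)) atTop (𝓝 0) :=
  (tendsto_const_nhds (x := C)).div_atTop
    (Real.tendsto_sqrt_atTop.comp tendsto_natCast_atTop_atTop)

section Limits

variable {I 𝕜 : Type*} [RCLike 𝕜] [DecidableEq I] {K : ℕ → ℝ} {S : I → Set (ℝ × ℝ)}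
  {val : ∀ N, List ((I × Fin N × Fin N) × Bool) → 𝕜}

/-- The diagonal contributions to a word converge almost everywhere. -/
theorem ae_exists_tendsto_diagMoment (hS : ∀ p, IsPattern (S p)) (hK : ∀ n, 0 ≤ K n)
    (hv : ∀ N, EntryMoments K N (fillMask 𝕜 S N) (val N)) (w : List (I × Bool)) :
    ∀ᵐ x ∂unitMeasure, ∃ L, Tendsto (fun N => stepFun N (diagMoment (val N) w) x) atTop (𝓝 L) := by
  have hmem : ∀ᵐ x ∂unitMeasure, x ∈ Set.Ico (0 : ℝ) 1 := ae_restrict_mem measurableSet_Ico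
  induction hn : w.length using Nat.strong_induction_on generalizing w with
  | _ n ih =>
  cases w with
  | nil =>
    filter_upwards [hmem] with x hx
    refine ⟨1, tendsto_const_nhds.congr' ?_⟩
    filter_upwards [eventually_gt_atTop 0] with N hN
    obtain ⟨a, -, -, ha⟩ := exists_cell 𝕜 hN hx
    rw [ha, (hv N).diagMoment_nil]
  | cons l w =>
    simp only [List.length_cons] at hn
    obtain ⟨C, hC⟩ := EntryMoments.diagMoment_recursion (𝕜 := 𝕜) K hK l w
    have hV : ∀ᵐ x ∂unitMeasure, ∀ j : ℕ, j < w.length →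
        ∃ L, Tendsto (fun N => stepFun N (diagMoment (val N) (w.drop (j + 1))) x) atTop (𝓝 L) := by
      refine ae_all_iff.2 fun j => ?_
      by_cases hj : j < w.length
      · filter_upwards [ih (w.drop (j + 1)).length (by simp; omega) (w.drop (j + 1)) rfl] with x hx
        exact fun _ => hx
      · exact ae_of_all _ fun x h => absurd h hj
    filter_upwards [hmem, hV, ae_ae_exists_tendsto_fillMask (𝕜 := 𝕜) l (hS l.1)] with x hx hVx hM
    -- The integrand whose integral over `y` is the inner average of the recursion (`hF` below). At
    -- a fixed good `x` it converges for almost every `y`, so dominated convergence applies.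
    let F : ℕ → ℕ → ℝ → 𝕜 := fun j N y =>
      stepFun N (fun a => stepFun N (fun b => fillMask 𝕜 S N (step l a b).1) y) x *
        stepFun N (diagMoment (val N) (w.take j)) y
    have hU : ∀ j, j < w.length → ∃ L, Tendsto (fun N => ∫ y, F j N y ∂unitMeasure)
        atTop (𝓝 L) := by
      intro j hj
      obtain ⟨B, hB0, hB⟩ := EntryMoments.exists_norm_diagMoment_le (𝕜 := 𝕜) K hK (w.take j)
      refine exists_tendsto_integral (C := 1 * B) ?_ ?_ ?_
      · intro N
        refine Measurable.mul ?_ (measurable_stepFun _ _)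
        by_cases h : ⌊x * N⌋₊ < N
        · have he : (fun y => stepFun N (fun a => stepFun N
              (fun b => fillMask 𝕜 S N (step l a b).1) y) x) =
              stepFun N fun b => fillMask 𝕜 S N (step l ⟨_, h⟩ b).1 := funext fun y => dif_pos h
          rw [he]
          exact measurable_stepFun _ _
        · have he : (fun y => stepFun N (fun a => stepFun N
              (fun b => fillMask 𝕜 S N (step l a b).1) y) x) = fun _ => 0 :=
            funext fun y => dif_neg h
          rw [he]
          exact measurable_const
      · intro N y
        rw [norm_mul]
        exact mul_le_mul (norm_stepFun_le zero_le_one (fun a => norm_stepFun_le zero_le_one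
          (fun b => norm_fillMask_le _ _ _) _) _)
          (norm_stepFun_le hB0 (hB N _ _ (hv N)) _) (norm_nonneg _) zero_le_one
      · filter_upwards [hM, ih (w.take j).length (by simp; omega) (w.take j) rfl] with y h1 h2
        obtain ⟨L₁, h1⟩ := h1
        obtain ⟨L₂, h2⟩ := h2
        exact ⟨L₁ * L₂, h1.mul h2⟩
    choose! LU hLU using hU
    choose! LV hLV using hVx
    have hsum : Tendsto (fun N => ∑ j ∈ Finset.range w.length,
        if w[j]? = some (l.1, !l.2) then (∫ y, F j N y ∂unitMeasure) *
          stepFun N (diagMoment (val N) (w.drop (j + 1))) x else 0) atTop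
        (𝓝 (∑ j ∈ Finset.range w.length,
          if w[j]? = some (l.1, !l.2) then LU j * LV j else 0)) := by
      refine tendsto_finsetSum _ fun j hj => ?_
      have hj := Finset.mem_range.1 hj
      split_ifs
      · exact (hLU j hj).mul (hLV j hj)
      · exact tendsto_const_nhds
    have hdiff : Tendsto (fun N => stepFun N (diagMoment (val N) (l :: w)) x -
        ∑ j ∈ Finset.range w.length, if w[j]? = some (l.1, !l.2) then
          (∫ y, F j N y ∂unitMeasure) * stepFun N (diagMoment (val N) (w.drop (j + 1))) x
          else 0) atTop (𝓝 0) := by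
      refine squeeze_zero_norm' (a := fun N : ℕ => C / √(N : ℝ)) ?_ (tendsto_const_div_sqrt C)
      filter_upwards [eventually_gt_atTop 0] with N hN
      obtain ⟨a, -, -, ha⟩ := exists_cell 𝕜 hN hx
      have h1 := hC N _ _ (hv N) a
      have hF : ∀ j, ∫ y, F j N y ∂unitMeasure =
          (∑ b, fillMask 𝕜 S N (step l a b).1 * diagMoment (val N) (w.take j) b) / N := by
        intro j
        rw [← integral_stepFun]
        refine integral_congr_ae (ae_of_all _ fun y => ?_)
        simp only [F, ha]
        unfold stepFun
        split_ifs <;> simp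
      simp only [ha, hF]
      exact h1
    have := hdiff.add hsum
    simp only [sub_add_cancel] at this
    exact ⟨_, this⟩

/-- The normalized contributions of the closed walks to a word. -/
def avgMoment {N : ℕ} (val : List ((I × Fin N × Fin N) × Bool) → 𝕜) (w : List (I × Bool)) : 𝕜 :=
  (N : 𝕜)⁻¹ * ∑ a, diagMoment val w a

theorem exists_tendsto_avgMoment (hS : ∀ p, IsPattern (S p)) (hK : ∀ n, 0 ≤ K n)
    (hv : ∀ N, EntryMoments K N (fillMask 𝕜 S N) (val N)) (w : List (I × Bool)) :
    ∃ L, Tendsto (fun N => avgMoment (val N) w) atTop (𝓝 L) := by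
  obtain ⟨B, hB0, hB⟩ := EntryMoments.exists_norm_diagMoment_le (𝕜 := 𝕜) K hK w
  obtain ⟨L, hL⟩ := exists_tendsto_integral
    (F := fun N => stepFun N (diagMoment (val N) w)) (fun N => measurable_stepFun _ _)
    (fun N x => norm_stepFun_le hB0 (hB N _ _ (hv N)) x)
    (ae_exists_tendsto_diagMoment hS hK hv w)
  refine ⟨L, hL.congr fun N => ?_⟩
  rw [integral_stepFun, avgMoment, div_eq_inv_mul]

/-- The Schwinger-Dyson equation for a letter of a full matrix. -/
theorem limit_cons_eq_splitSum (hK : ∀ n, 0 ≤ K n)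
    (hv : ∀ N, EntryMoments K N (fillMask 𝕜 S N) (val N)) {T : List (I × Bool) → 𝕜}
    (hT : ∀ w, Tendsto (fun N => avgMoment (val N) w) atTop (𝓝 (T w))) {l : I × Bool}
    (hl : S l.1 = unitSquare) (w : List (I × Bool)) :
    T (l :: w) = splitSum (l.1, !l.2) (fun u v => T u * T v) w := by
  obtain ⟨C, hC⟩ := EntryMoments.diagMoment_recursion (𝕜 := 𝕜) K hK l w
  have hsum : Tendsto (fun N => splitSum (l.1, !l.2)
      (fun u v => avgMoment (val N) u * avgMoment (val N) v) w) atTop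
      (𝓝 (splitSum (l.1, !l.2) (fun u v => T u * T v) w)) := by
    refine tendsto_finsetSum _ fun j _ => ?_
    split_ifs
    · exact (hT _).mul (hT _)
    · exact tendsto_const_nhds
  have hdiff : Tendsto (fun N => avgMoment (val N) (l :: w) - splitSum (l.1, !l.2)
      (fun u v => avgMoment (val N) u * avgMoment (val N) v) w) atTop (𝓝 0) := by
    refine squeeze_zero_norm' (a := fun N : ℕ => C / √(N : ℝ)) ?_ (tendsto_const_div_sqrt C)
    filter_upwards [eventually_gt_atTop 0] with N hN
    have hN0 : (N : 𝕜) ≠ 0 := by exact_mod_cast hN.ne'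
    -- The inner average therefore does not depend on `a`, and the average over `a` becomes a
    -- product of two averages.
    have hmask : ∀ a b, fillMask 𝕜 S N (step l a b).1 = 1 := fun a b => fillMask_unitSquare hl
    have h1 : avgMoment (val N) (l :: w) - splitSum (l.1, !l.2)
        (fun u v => avgMoment (val N) u * avgMoment (val N) v) w =
        (N : 𝕜)⁻¹ * ∑ a, (diagMoment (val N) (l :: w) a - splitSum (l.1, !l.2) (fun u v =>
          (∑ b, fillMask 𝕜 S N (step l a b).1 * diagMoment (val N) u b) / N *
            diagMoment (val N) v a) w) := by
      rw [Finset.sum_sub_distrib, mul_sub, avgMoment]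
      congr 1
      simp only [splitSum, hmask, one_mul]
      rw [Finset.sum_comm, Finset.mul_sum]
      refine Finset.sum_congr rfl fun j _ => ?_
      split_ifs
      · rw [← Finset.mul_sum, avgMoment, avgMoment]
        ring
      · simp
    rw [h1, norm_mul, norm_inv, RCLike.norm_natCast, inv_mul_le_iff₀ (by exact_mod_cast hN)]
    refine (norm_sum_le_of_le _ fun a _ => hC N _ _ (hv N) a).trans_eq ?_
    simp
  have := hdiff.add hsum
  simp only [sub_add_cancel, zero_add] at this
  exact tendsto_nhds_unique (hT _) this

end Limits

/-! ### Splittings of words, monomials and centering. -/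

section SplitSum

variable {β : Type*} [DecidableEq β]

lemma splitSum_append {M : Type*} [AddCommMonoid M] (l : β) (f : List β → List β → M)
    (w w' : List β) :
    splitSum l f (w ++ w') =
      splitSum l (fun u v => f u (v ++ w')) w + splitSum l (fun u v => f (w ++ u) v) w' := by
  rw [splitSum, List.length_append, Finset.sum_range_add]
  congr 1
  · refine Finset.sum_congr rfl fun j hj => ?_
    have hj := Finset.mem_range.1 hj
    rw [List.getElem?_append_left hj, List.take_append_of_le_length hj.le,
      List.drop_append_of_le_length hj]
  · refine Finset.sum_congr rfl fun j _ => ?_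
    rw [List.getElem?_append_right (by omega), Nat.add_sub_cancel_left, List.take_length_add_append,
      Nat.add_assoc, List.drop_length_add_append]

lemma splitSum_congr {M : Type*} [AddCommMonoid M] {l : β} {f g : List β → List β → M}
    {w : List β} (h : ∀ u v, w = u ++ l :: v → f u v = g u v) :
    splitSum l f w = splitSum l g w := by
  refine Finset.sum_congr rfl fun j _ => ?_
  split_ifs with hj
  · exact h _ _ (take_append_cons_drop hj).1
  · rfl

lemma splitSum_eq_zero {M : Type*} [AddCommMonoid M] {l : β} {f : List β → List β → M}
    {w : List β} (h : ∀ u v, w = u ++ l :: v → f u v = 0) : splitSum l f w = 0 := by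
  rw [splitSum_congr (g := fun _ _ => 0) h]
  simp [splitSum]

lemma splitSum_sub_mul {R : Type*} [CommRing R] (l : β) (f g : List β → List β → R) (c : R)
    (w : List β) :
    splitSum l (fun u v => f u v - g u v * c) w = splitSum l f w - splitSum l g w * c := by
  simp only [splitSum]
  rw [Finset.sum_mul, ← Finset.sum_sub_distrib]
  refine Finset.sum_congr rfl fun j _ => ?_
  split_ifs <;> simp

end SplitSum

section Free

variable {𝕜 : Type*} [RCLike 𝕜] {I : Type*}

/-- The noncommutative monomial of a word. -/
def monomial (𝕜 : Type*) [RCLike 𝕜] (w : List (I × Bool)) : NCPoly 𝕜 I :=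
  (w.map (FreeAlgebra.ι 𝕜)).prod

lemma monomial_nil : monomial 𝕜 ([] : List (I × Bool)) = 1 := rfl

lemma monomial_cons (l : I × Bool) (w : List (I × Bool)) :
    monomial 𝕜 (l :: w) = FreeAlgebra.ι 𝕜 l * monomial 𝕜 w := by
  simp [monomial]

lemma monomial_append (w w' : List (I × Bool)) :
    monomial 𝕜 (w ++ w') = monomial 𝕜 w * monomial 𝕜 w' := by
  simp [monomial]

/-- Monomials form a basis, so linear functionals may be defined and compared on words. -/
lemma basisFreeMonoid_apply (w : FreeMonoid (I × Bool)) :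
    FreeAlgebra.basisFreeMonoid 𝕜 (I × Bool) w = monomial 𝕜 w.toList := by
  have : FreeAlgebra.basisFreeMonoid 𝕜 (I × Bool) w =
      FreeAlgebra.equivMonoidAlgebraFreeMonoid.symm (MonoidAlgebra.single w (1 : 𝕜)) := rfl
  rw [this, AlgEquiv.symm_apply_eq]
  clear this
  induction w using FreeMonoid.inductionOn' with
  | one => simp [monomial, MonoidAlgebra.one_def]
  | of_mul l w ih =>
    rw [FreeMonoid.toList_of_mul, monomial_cons, map_mul, ← ih]
    simp [FreeAlgebra.equivMonoidAlgebraFreeMonoid, MonoidAlgebra.single_mul_single]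

lemma linearMap_ext_monomial {M : Type*} [AddCommMonoid M] [Module 𝕜 M] {f g : NCPoly 𝕜 I →ₗ[𝕜] M}
    (h : ∀ w, f (monomial 𝕜 w) = g (monomial 𝕜 w)) : f = g :=
  (FreeAlgebra.basisFreeMonoid 𝕜 (I × Bool)).ext fun w => by
    rw [basisFreeMonoid_apply, h]

lemma span_monomial : Submodule.span 𝕜 (Set.range (monomial 𝕜 (I := I))) = ⊤ := by
  rw [← (FreeAlgebra.basisFreeMonoid 𝕜 (I × Bool)).span_eq]
  congr 1
  ext P
  simp only [Set.mem_range, basisFreeMonoid_apply]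
  exact ⟨fun ⟨w, h⟩ => ⟨FreeMonoid.ofList w, h⟩, fun ⟨w, h⟩ => ⟨w.toList, h⟩⟩

lemma groupAlgebra_le_span {G : Type*} (c : I → G) (g : G) {P : NCPoly 𝕜 I}
    (hP : P ∈ groupAlgebra (𝕜 := 𝕜) c g) :
    P ∈ Submodule.span 𝕜 (monomial 𝕜 '' {w | ∀ l ∈ w, c l.1 = g}) := by
  have h1 : P ∈ Subalgebra.toSubmodule (groupAlgebra (𝕜 := 𝕜) c g) := hP
  rw [groupAlgebra, Algebra.adjoin_eq_span] at h1
  refine Submodule.span_mono ?_ h1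
  intro Q hQ
  induction hQ using Submonoid.closure_induction with
  | mem Q hQ =>
    obtain ⟨i, s, hi, rfl⟩ := hQ
    refine ⟨[(i, s)], fun l hl => ?_, by simp [monomial]⟩
    obtain rfl := List.mem_singleton.1 hl
    exact hi
  | one => exact ⟨[], by simp, rfl⟩
  | mul Q Q' _ _ h h' =>
    obtain ⟨w, hw, rfl⟩ := h
    obtain ⟨w', hw', rfl⟩ := h'
    refine ⟨w ++ w', fun l hl => ?_, monomial_append w w'⟩
    rcases List.mem_append.1 hl with hl | hl
    exacts [hw l hl, hw' l hl]

/-- The centering of a monomial. -/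
def centered (τ : NCPoly 𝕜 I →ₗ[𝕜] 𝕜) (w : List (I × Bool)) : NCPoly 𝕜 I :=
  monomial 𝕜 w - τ (monomial 𝕜 w) • 1

/-- The product of the centered monomials of a list of words. -/
def centeredProd {G : Type*} (τ : NCPoly 𝕜 I →ₗ[𝕜] 𝕜) (L : List (G × List (I × Bool))) :
    NCPoly 𝕜 I :=
  (L.map fun a => centered τ a.2).prod

/-- A list of words in the variables of one group each, with consecutive groups different. -/
structure IsAlternating {G : Type*} (c : I → G) (L : List (G × List (I × Bool))) : Prop where
  chain : (L.map Prod.fst).IsChain (· ≠ ·)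
  mem : ∀ a ∈ L, ∀ l ∈ a.2, c l.1 = a.1

/-- The total length of the words of a list. -/
def totalLength {G : Type*} (L : List (G × List (I × Bool))) : ℕ :=
  (L.map fun a => a.2.length).sum

section CenteredProd

variable {G : Type*} (τ : NCPoly 𝕜 I →ₗ[𝕜] 𝕜)

lemma centeredProd_append (L L' : List (G × List (I × Bool))) :
    centeredProd τ (L ++ L') = centeredProd τ L * centeredProd τ L' := by
  simp [centeredProd]

lemma centeredProd_cons (a : G × List (I × Bool)) (L : List (G × List (I × Bool))) :
    centeredProd τ (a :: L) = centered τ a.2 * centeredProd τ L := by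
  simp [centeredProd]

lemma centeredProd_singleton (a : G × List (I × Bool)) :
    centeredProd τ [a] = centered τ a.2 := by
  simp [centeredProd]

lemma centeredProd_nil : centeredProd τ ([] : List (G × List (I × Bool))) = 1 := rfl

/-- Centered polynomials in the variables of one group are combinations of centered monomials. -/
lemma mem_span_centered (c : I → G) (g : G) {P : NCPoly 𝕜 I}
    (hP : P ∈ groupAlgebra (𝕜 := 𝕜) c g) (h0 : τ P = 0) :
    P ∈ Submodule.span 𝕜 (centered τ '' {w | ∀ l ∈ w, c l.1 = g}) := by
  have key : ∀ Q ∈ Submodule.span 𝕜 (monomial 𝕜 '' {w | ∀ l ∈ w, c l.1 = g}),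
      Q - τ Q • 1 ∈ Submodule.span 𝕜 (centered τ '' {w | ∀ l ∈ w, c l.1 = g}) := by
    intro Q hQ
    induction hQ using Submodule.span_induction with
    | mem Q hQ =>
      obtain ⟨w, hw, rfl⟩ := hQ
      exact Submodule.subset_span ⟨w, hw, rfl⟩
    | zero => simp
    | add Q Q' _ _ h h' =>
      have := Submodule.add_mem _ h h'
      rw [map_add, add_smul]
      convert this using 1
      abel
    | smul r Q _ h =>
      have := Submodule.smul_mem _ r h
      rw [map_smul, smul_assoc, ← smul_sub]
      exact this
  have := key P (groupAlgebra_le_span c g hP)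
  rwa [h0, zero_smul, sub_zero] at this

end CenteredProd

/-! ### Freeness from the Schwinger-Dyson equations. -/

section SchwingerDyson

variable [DecidableEq I] (τ : NCPoly 𝕜 I →ₗ[𝕜] 𝕜)

/-- The bilinear functional `R, P ↦ (τ ⊗ τ) ((P ⊗ 1) * ∂ R)`, where `∂` is the free difference
quotient with respect to the letter `l`. -/
def diffPairing (l : I × Bool) : NCPoly 𝕜 I →ₗ[𝕜] NCPoly 𝕜 I →ₗ[𝕜] 𝕜 :=
  (FreeAlgebra.basisFreeMonoid 𝕜 (I × Bool)).constr 𝕜 fun r =>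
    splitSum l (fun u v => τ (monomial 𝕜 v) • (τ ∘ₗ LinearMap.mulRight 𝕜 (monomial 𝕜 u))) r.toList

lemma diffPairing_monomial (l : I × Bool) (r : List (I × Bool)) (P : NCPoly 𝕜 I) :
    diffPairing τ l (monomial 𝕜 r) P =
      splitSum l (fun u v => τ (P * monomial 𝕜 u) * τ (monomial 𝕜 v)) r := by
  have h : monomial 𝕜 r = FreeAlgebra.basisFreeMonoid 𝕜 (I × Bool) (FreeMonoid.ofList r) :=
    (basisFreeMonoid_apply _).symm
  rw [h, diffPairing, Module.Basis.constr_basis, FreeMonoid.toList_ofList]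
  simp only [splitSum, LinearMap.sum_apply]
  refine Finset.sum_congr rfl fun j _ => ?_
  split_ifs
  · simp [mul_comm]
  · rfl

lemma diffPairing_one (l : I × Bool) (P : NCPoly 𝕜 I) : diffPairing τ l 1 P = 0 := by
  rw [← monomial_nil, diffPairing_monomial]
  rfl

/-- The Leibniz rule. -/
lemma diffPairing_monomial_mul (l : I × Bool) (r : List (I × Bool)) (R P : NCPoly 𝕜 I) :
    diffPairing τ l (monomial 𝕜 r * R) P =
      splitSum l (fun u v => τ (P * monomial 𝕜 u) * τ (monomial 𝕜 v * R)) r +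
        diffPairing τ l R (P * monomial 𝕜 r) := by
  have hR : R ∈ Submodule.span 𝕜 (Set.range (monomial 𝕜 (I := I))) := by
    rw [span_monomial]; trivial
  induction hR using Submodule.span_induction with
  | mem R hR =>
    obtain ⟨w, rfl⟩ := hR
    rw [← monomial_append, diffPairing_monomial, diffPairing_monomial, splitSum_append]
    simp only [monomial_append, mul_assoc]
  | zero => simp [splitSum]
  | add R R' _ _ h h' =>
    rw [mul_add, map_add, LinearMap.add_apply, h, h', map_add, LinearMap.add_apply]
    have : splitSum l (fun u v => τ (P * monomial 𝕜 u) * τ (monomial 𝕜 v * (R + R'))) r =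
        splitSum l (fun u v => τ (P * monomial 𝕜 u) * τ (monomial 𝕜 v * R)) r +
          splitSum l (fun u v => τ (P * monomial 𝕜 u) * τ (monomial 𝕜 v * R')) r := by
      simp only [splitSum, ← Finset.sum_add_distrib]
      refine Finset.sum_congr rfl fun j _ => ?_
      split_ifs
      · rw [mul_add, map_add, mul_add]
      · simp
    rw [this]
    abel
  | smul s R _ h =>
    rw [mul_smul_comm, map_smul, LinearMap.smul_apply, h, map_smul, LinearMap.smul_apply, smul_add]
    congr 1
    simp only [splitSum, Finset.smul_sum]
    refine Finset.sum_congr rfl fun j _ => ?_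
    split_ifs
    · rw [mul_smul_comm, map_smul, smul_eq_mul, smul_eq_mul]
      ring
    · simp

/-- The difference quotient kills constants, so centering affects the factor that is passed over but
not the one that is differentiated. -/
lemma diffPairing_centered_mul (l : I × Bool) (r : List (I × Bool)) (R P : NCPoly 𝕜 I) :
    diffPairing τ l (centered τ r * R) P =
      splitSum l (fun u v => τ (P * monomial 𝕜 u) * τ (monomial 𝕜 v * R)) r +
        diffPairing τ l R (P * centered τ r) := by
  rw [centered, sub_mul, map_sub, LinearMap.sub_apply, diffPairing_monomial_mul, mul_sub, map_sub,
    smul_mul_assoc, one_mul, map_smul, LinearMap.smul_apply, mul_smul_comm, mul_one, map_smul]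
  abel

variable {τ}

lemma apply_ι_mul {l : I × Bool} (hl : ∀ w, τ (monomial 𝕜 (l :: w)) =
      splitSum (l.1, !l.2) (fun u v => τ (monomial 𝕜 u) * τ (monomial 𝕜 v)) w)
    (R : NCPoly 𝕜 I) :
    τ (FreeAlgebra.ι 𝕜 l * R) = diffPairing τ (l.1, !l.2) R 1 := by
  have : τ ∘ₗ LinearMap.mulLeft 𝕜 (FreeAlgebra.ι 𝕜 l) = (diffPairing τ (l.1, !l.2)).flip 1 := by
    refine linearMap_ext_monomial fun w => ?_
    rw [LinearMap.flip_apply, diffPairing_monomial, LinearMap.comp_apply,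
      LinearMap.mulLeft_apply, ← monomial_cons, hl]
    simp
  exact LinearMap.congr_fun this R

variable {c : I → Fin 2}

/-- The product of an alternating list of centered monomials is centered, if that is known for
shorter lists. -/
lemma apply_centeredProd_aux (htr : ∀ P Q, τ (P * Q) = τ (Q * P))
    (hτ1 : τ 1 = 1)
    (hSD : ∀ l : I × Bool, c l.1 = 1 → ∀ w, τ (monomial 𝕜 (l :: w)) =
      splitSum (l.1, !l.2) (fun u v => τ (monomial 𝕜 u) * τ (monomial 𝕜 v)) w)
    {A B : List (Fin 2 × List (I × Bool))} {w : List (I × Bool)}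
    (hA : A = [] ∨ ∃ r, A = [(0, r)])
    (hL : IsAlternating c (A ++ (1, w) :: B))
    (ih : ∀ L' : List (Fin 2 × List (I × Bool)), L' ≠ [] → IsAlternating c L' →
      totalLength L' < totalLength (A ++ (1, w) :: B) → τ (centeredProd τ L') = 0) :
    τ (centeredProd τ (A ++ (1, w) :: B)) = 0 := by
  cases w with
  | nil =>
    have : centered τ ([] : List (I × Bool)) = 0 := by
      rw [centered, monomial_nil, hτ1, one_smul, sub_self]
    rw [centeredProd_append, centeredProd_cons, this, zero_mul, mul_zero, map_zero]
  | cons l q =>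
    have hlq : ∀ l' ∈ l :: q, c l'.1 = 1 := hL.mem (1, l :: q) (by simp)
    have hl : c l.1 = 1 := hlq l (by simp)
    have hnot : ∀ a ∈ A ++ (1, l :: q) :: B, a.1 = 0 → ∀ u v, a.2 ≠ u ++ (l.1, !l.2) :: v := by
      intro a ha ha0 u v h
      have := hL.mem a ha (l.1, !l.2) (by simp [h])
      rw [ha0] at this
      exact absurd (this.symm.trans hl) (by decide)
    -- By traciality `A` is moved to the end, so that the word containing `l` stands first.
    set R := centeredProd τ B * centeredProd τ A with hR
    have h1 : τ (centeredProd τ (A ++ (1, l :: q) :: B)) =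
        τ (FreeAlgebra.ι 𝕜 l * (monomial 𝕜 q * R)) - τ (monomial 𝕜 (l :: q)) * τ R := by
      rw [centeredProd_append, centeredProd_cons, htr, mul_assoc, ← hR, centered, sub_mul, map_sub,
        smul_mul_assoc, one_mul, map_smul, smul_eq_mul, monomial_cons, mul_assoc]
    -- No contribution arises when the partner of `l` lies in a word other than its own. Here `D`
    -- collects the factors of `B` already passed and `E` those still to be differentiated.
    have h2 : ∀ E D, B = D ++ E → diffPairing τ (l.1, !l.2) (centeredProd τ E * centeredProd τ A)
        (monomial 𝕜 q * centeredProd τ D) = 0 := by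
      intro E
      induction E with
      | nil =>
        intro D _
        rw [centeredProd_nil, one_mul]
        rcases hA with rfl | ⟨r, rfl⟩
        · rw [centeredProd_nil, diffPairing_one]
        · rw [centeredProd_singleton, ← mul_one (centered τ _), diffPairing_centered_mul,
            diffPairing_one, add_zero]
          exact splitSum_eq_zero fun u v h => absurd h (hnot (0, r) (by simp) rfl u v)
      | cons a E ihE =>
        intro D hD
        rw [centeredProd_cons, mul_assoc, diffPairing_centered_mul, mul_assoc,
          ← centeredProd_singleton, ← centeredProd_append τ D, ihE (D ++ [a]) (by simp [hD]), add_zero]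
        refine splitSum_eq_zero fun u v huv => ?_
        obtain ⟨g, r⟩ := a
        have hg : g = 1 := by
          by_contra hg
          have hg0 : g = 0 := by omega
          exact hnot (g, r) (by simp [hD]) hg0 u v huv
        subst hg
        dsimp only at huv
        subst huv hD
        have hchain := hL.chain
        simp only [List.map_append, List.map_cons] at hchain
        -- Two words of the second group cannot be neighbours, so some word separates them.
        have hD0 : D ≠ [] := by
          rintro rfl
          have := hchain.infix (l₁ := [1, 1]) ⟨A.map Prod.fst, E.map Prod.fst, by simp⟩
          simp at this
        have hlen : ∀ L₁ L₂ L₃ : List (Fin 2 × List (I × Bool)), totalLength (L₁ ++ L₂ ++ L₃) =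
            totalLength L₁ + totalLength L₂ + totalLength L₃ := by
          intro L₁ L₂ L₃
          simp [totalLength, add_assoc]
        have hqm : ∀ l' ∈ q, c l'.1 = 1 := fun l' hl' => hlq l' (by simp [hl'])
        have hum : ∀ l' ∈ u, c l'.1 = 1 := fun l' hl' =>
          hL.mem (1, u ++ (l.1, !l.2) :: v) (by simp) l' (by simp [hl'])
        have hDm : ∀ a ∈ D, ∀ l ∈ a.2, c l.1 = a.1 := fun a ha => hL.mem a (by simp [ha])
        -- These four products come from writing `q` and `u` as centered part plus scalar. All stay
        -- alternating and are shorter, since `l` and its partner have been removed.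
        have hi : ∀ L₁ L₃ : List (Fin 2 × List (I × Bool)), (L₁ = [] ∨ L₁ = [(1, q)]) →
            (L₃ = [] ∨ L₃ = [(1, u)]) → τ (centeredProd τ (L₁ ++ D ++ L₃)) = 0 := by
          intro L₁ L₃ h₁ h₃
          refine ih _ (by simp [hD0]) ⟨?_, ?_⟩ ?_
          · refine hchain.infix ?_
            rcases h₁ with rfl | rfl <;> rcases h₃ with rfl | rfl
            · exact ⟨A.map Prod.fst ++ [1], 1 :: E.map Prod.fst, by simp⟩
            · exact ⟨A.map Prod.fst ++ [1], E.map Prod.fst, by simp⟩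
            · exact ⟨A.map Prod.fst, 1 :: E.map Prod.fst, by simp⟩
            · exact ⟨A.map Prod.fst, E.map Prod.fst, by simp⟩
          · intro a ha
            simp only [List.mem_append] at ha
            rcases ha with (ha | ha) | ha
            · rcases h₁ with rfl | rfl
              · simp at ha
              · obtain rfl := List.mem_singleton.1 ha
                exact hqm
            · exact hDm a ha
            · rcases h₃ with rfl | rfl
              · simp at ha
              · obtain rfl := List.mem_singleton.1 ha
                exact hum
          · rw [hlen]
            have : totalLength (A ++ (1, l :: q) :: (D ++ (1, u ++ (l.1, !l.2) :: v) :: E)) =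
                totalLength A + (q.length + 1) + totalLength D + (u.length + (v.length + 1)) +
                  totalLength E := by
              simp [totalLength]
              omega
            rw [this]
            have h4 : totalLength L₁ ≤ q.length := by
              rcases h₁ with rfl | rfl <;> simp [totalLength]
            have h5 : totalLength L₃ ≤ u.length := by
              rcases h₃ with rfl | rfl <;> simp [totalLength]
            omega
        have hq : monomial 𝕜 q = centered τ q + τ (monomial 𝕜 q) • 1 := by simp [centered]
        have hu : monomial 𝕜 u = centered τ u + τ (monomial 𝕜 u) • 1 := by simp [centered]
        have h00 := hi [] [] (by simp) (by simp)
        have h01 := hi [] [(1, u)] (by simp) (by simp)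
        have h10 := hi [(1, q)] [] (by simp) (by simp)
        have h11 := hi [(1, q)] [(1, u)] (by simp) (by simp)
        simp only [centeredProd_append, centeredProd_singleton, centeredProd_nil, one_mul,
          mul_one] at h00 h01 h10 h11
        rw [hq, hu]
        simp only [add_mul, mul_add, map_add, smul_mul_assoc, mul_smul_comm, one_mul, mul_one,
          map_smul, h00, h01, h10, h11, smul_zero, add_zero]
        simp
    have h3 := h2 B [] rfl
    rw [centeredProd_nil, mul_one, ← hR] at h3
    rw [h1, apply_ι_mul (hSD l hl), diffPairing_monomial_mul, one_mul, h3, add_zero, hSD l hl,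
      ← splitSum_sub_mul]
    refine splitSum_eq_zero fun u v huv => ?_
    -- When the partner lies in the same word, the subtracted term recenters exactly the remainder
    -- `v`, which takes the place of the original word.
    have h4 := ih (A ++ (1, v) :: B) (by simp) ⟨by simpa using hL.chain, ?_⟩ ?_
    · rw [centeredProd_append, centeredProd_cons, htr, mul_assoc, ← hR, centered, sub_mul, map_sub,
        smul_mul_assoc, one_mul, map_smul, smul_eq_mul] at h4
      rw [one_mul]
      linear_combination τ (monomial 𝕜 u) * h4
    · intro a ha
      simp only [List.mem_append, List.mem_cons] at ha
      rcases ha with ha | rfl | ha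
      · exact hL.mem a (by simp [ha])
      · exact fun l' hl' => hlq l' (by simp [huv, hl'])
      · exact hL.mem a (by simp [ha])
    · simp [totalLength, huv]
      omega

/-- Unless the list is a single word of the first group, which is trivial, a word of the second
group stands in first or second place. -/
theorem apply_centeredProd (htr : ∀ P Q, τ (P * Q) = τ (Q * P)) (hτ1 : τ 1 = 1)
    (hSD : ∀ l : I × Bool, c l.1 = 1 → ∀ w, τ (monomial 𝕜 (l :: w)) =
      splitSum (l.1, !l.2) (fun u v => τ (monomial 𝕜 u) * τ (monomial 𝕜 v)) w)
    (L : List (Fin 2 × List (I × Bool))) (hne : L ≠ []) (hL : IsAlternating c L) :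
    τ (centeredProd τ L) = 0 := by
  induction hn : totalLength L using Nat.strong_induction_on generalizing L with
  | _ n ih =>
  have ih' : ∀ L' : List (Fin 2 × List (I × Bool)), L' ≠ [] → IsAlternating c L' →
      totalLength L' < totalLength L → τ (centeredProd τ L') = 0 :=
    fun L' h1 h2 h3 => ih _ (hn ▸ h3) L' h1 h2 rfl
  have hg : ∀ g : Fin 2, g = 0 ∨ g = 1 := by omega
  match L, hne with
  | (g, w) :: M, _ =>
    rcases hg g with rfl | rfl
    · match M with
      | [] =>
        rw [centeredProd_singleton, centered, map_sub, map_smul, hτ1, smul_eq_mul, mul_one,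
          sub_self]
      | (g', w') :: M =>
        have hg' : g' = 1 := by
          have := hL.chain
          simp only [List.map_cons, List.isChain_cons_cons] at this
          exact (hg g').resolve_left (Ne.symm this.1)
        subst hg'
        exact apply_centeredProd_aux (A := [(0, w)]) htr hτ1 hSD (Or.inr ⟨w, rfl⟩) hL ih'
    · exact apply_centeredProd_aux (A := []) htr hτ1 hSD (Or.inl rfl) hL ih'

/-- A trace which satisfies the Schwinger-Dyson equations of free circular elements for the
variables of the second group makes the two groups free. -/
theorem groupsFree_of_schwingerDyson (htr : ∀ P Q, τ (P * Q) = τ (Q * P)) (hτ1 : τ 1 = 1)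
    (hSD : ∀ l : I × Bool, c l.1 = 1 → ∀ w, τ (monomial 𝕜 (l :: w)) =
      splitSum (l.1, !l.2) (fun u v => τ (monomial 𝕜 u) * τ (monomial 𝕜 v)) w) :
    GroupsFree c τ := by
  -- Multilinearity, one factor at a time: `D` holds the factors already reduced to centered
  -- monomials, `L` those still arbitrary.
  have key : ∀ (L : List (Fin 2 × NCPoly 𝕜 I)) (D : List (Fin 2 × List (I × Bool))),
      (D.map Prod.fst ++ L.map Prod.fst) ≠ [] →
      (D.map Prod.fst ++ L.map Prod.fst).IsChain (· ≠ ·) →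
      (∀ a ∈ D, ∀ l ∈ a.2, c l.1 = a.1) →
      (∀ a ∈ L, a.2 ∈ Submodule.span 𝕜 (centered τ '' {w | ∀ l ∈ w, c l.1 = a.1})) →
      τ (centeredProd τ D * (L.map Prod.snd).prod) = 0 := by
    intro L
    induction L with
    | nil =>
      intro D hne hchain hD _
      simp only [List.map_nil, List.append_nil] at hne hchain
      rw [List.map_nil, List.prod_nil, mul_one]
      exact apply_centeredProd htr hτ1 hSD D (by simpa using hne) ⟨hchain, hD⟩
    | cons a L ih =>
      intro D hne hchain hD hL
      clear hne
      obtain ⟨g, P⟩ := a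
      have hP := hL (g, P) (by simp)
      simp only [List.map_cons, List.prod_cons] at hchain hP ⊢
      have hL' : ∀ a ∈ L, a.2 ∈ Submodule.span 𝕜 (centered τ '' {w | ∀ l ∈ w, c l.1 = a.1}) :=
        fun a ha => hL a (by simp [ha])
      clear hL
      induction hP using Submodule.span_induction with
      | mem P hP =>
        obtain ⟨w, hw, rfl⟩ := hP
        have := ih (D ++ [(g, w)]) (by simp) (by simpa using hchain) (by
          intro a ha
          rcases List.mem_append.1 ha with ha | ha
          · exact hD a ha
          · obtain rfl := List.mem_singleton.1 ha
            exact hw) hL'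
        rwa [centeredProd_append, centeredProd_singleton, mul_assoc] at this
      | zero => simp
      | add P Q _ _ hP hQ => rw [add_mul, mul_add, map_add, hP, hQ, add_zero]
      | smul s P _ hP => rw [smul_mul_assoc, mul_smul_comm, map_smul, hP, smul_zero]
  intro L hne hchain hL
  have := key L [] (by simpa using hne) (by simpa [List.isChain_map] using hchain) (by simp)
    fun a ha => mem_span_centered τ c a.1 (hL a ha).1 (hL a ha).2
  rwa [centeredProd_nil, one_mul] at this

end SchwingerDyson

end Free

/-! ### From words to polynomials, and the limit functional. -/

section Assembly

variable {𝕜 : Type*} [RCLike 𝕜] {I : Type*}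

lemma evalPoly_monomial {N : ℕ} (A : I → Matrix (Fin N) (Fin N) 𝕜) (w : List (I × Bool)) :
    evalPoly A (monomial 𝕜 w) = wordProd A w := by
  rw [monomial, map_list_prod, List.map_map, wordProd]
  congr 1
  refine List.map_congr_left fun l _ => ?_
  simp [evalPoly]

lemma evalPoly_monomial_map {N : ℕ} (A : I → Matrix (Fin N) (Fin N) 𝕜) (p : I)
    (C : Configuration) :
    evalPoly A (monomial 𝕜 (C.map fun s => (p, s))) = configPow (A p) C := by
  rw [evalPoly_monomial, wordProd, configPow, List.map_map]
  rfl

lemma monomial_mem_groupAlgebra {G : Type*} {c : I → G} {g : G} {w : List (I × Bool)}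
    (h : ∀ l ∈ w, c l.1 = g) : monomial 𝕜 w ∈ groupAlgebra (𝕜 := 𝕜) c g := by
  refine Subalgebra.list_prod_mem _ fun P hP => ?_
  obtain ⟨l, hl, rfl⟩ := List.mem_map.1 hP
  exact Algebra.subset_adjoin ⟨l.1, l.2, h l hl, rfl⟩

variable {Ω : Type*} [MeasurableSpace Ω] {μ : Measure Ω}

lemma integrable_trace {N : ℕ} {M : Ω → Matrix (Fin N) (Fin N) 𝕜}
    (h : ∀ a b, Integrable (fun ω => M ω a b) μ) : Integrable (fun ω => (M ω).trace) μ :=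
  integrable_finsetSum _ fun a _ => h a a

lemma expTr_add {N : ℕ} {M M' : Ω → Matrix (Fin N) (Fin N) 𝕜}
    (h : ∀ a b, Integrable (fun ω => M ω a b) μ) (h' : ∀ a b, Integrable (fun ω => M' ω a b) μ) :
    expTr μ (fun ω => M ω + M' ω) = expTr μ M + expTr μ M' := by
  simp only [expTr, Matrix.trace_add, mul_add]
  exact integral_add ((integrable_trace h).const_mul _) ((integrable_trace h').const_mul _)

lemma expTr_smul {N : ℕ} (s : 𝕜) (M : Ω → Matrix (Fin N) (Fin N) 𝕜) :
    expTr μ (fun ω => s • M ω) = s • expTr μ M := by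
  simp only [expTr, Matrix.trace_smul]
  rw [← integral_smul]
  congr 1
  funext ω
  simp only [smul_eq_mul]
  ring

variable [IsProbabilityMeasure μ]

lemma apply_one_of_tendsto {A : ∀ N : ℕ, I → Ω → Matrix (Fin N) (Fin N) 𝕜}
    {τ : NCPoly 𝕜 I →ₗ[𝕜] 𝕜}
    (h : Tendsto (fun N => expTr μ fun ω => evalPoly (fun p => A N p ω) 1) atTop (𝓝 (τ 1))) :
    τ 1 = 1 := by
  refine tendsto_nhds_unique h (tendsto_const_nhds.congr' ?_)
  filter_upwards [eventually_gt_atTop 0] with N hN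
  have hN0 : (N : 𝕜) ≠ 0 := by exact_mod_cast hN.ne'
  simp [expTr, hN0]

/-- Convergence on the monomials is convergence on all noncommutative polynomials. -/
lemma tendsto_expTr_evalPoly {A : ∀ N : ℕ, I → Ω → Matrix (Fin N) (Fin N) 𝕜}
    (hint : ∀ N w a b, Integrable (fun ω => wordProd (fun p => A N p ω) w a b) μ)
    {τ : NCPoly 𝕜 I →ₗ[𝕜] 𝕜}
    (h : ∀ w, Tendsto (fun N => expTr μ fun ω => wordProd (fun p => A N p ω) w) atTop
      (𝓝 (τ (monomial 𝕜 w)))) (P : NCPoly 𝕜 I) :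
    Tendsto (fun N => expTr μ fun ω => evalPoly (fun p => A N p ω) P) atTop (𝓝 (τ P)) := by
  have hP : P ∈ Submodule.span 𝕜 (Set.range (monomial 𝕜 (I := I))) := by
    rw [span_monomial]; trivial
  suffices hs : (∀ N a b, Integrable (fun ω => evalPoly (fun p => A N p ω) P a b) μ) ∧
      Tendsto (fun N => expTr μ fun ω => evalPoly (fun p => A N p ω) P) atTop (𝓝 (τ P)) from hs.2
  induction hP using Submodule.span_induction with
  | mem P hP =>
    obtain ⟨w, rfl⟩ := hP
    simp only [evalPoly_monomial]
    exact ⟨fun N => hint N w, h w⟩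
  | zero => simp [expTr]
  | add P Q _ _ hP hQ =>
    simp only [map_add]
    refine ⟨fun N a b => (hP.1 N a b).add (hQ.1 N a b), (hP.2.add hQ.2).congr fun N => ?_⟩
    rw [expTr_add (hP.1 N) (hQ.1 N)]
  | smul s P _ hP =>
    simp only [map_smul]
    refine ⟨fun N a b => (hP.1 N a b).smul s, (hP.2.const_smul s).congr fun N => ?_⟩
    rw [expTr_smul]

end Assembly

/-- The patterned matrices converge in distribution, and the two groups are free in the limit. -/
theorem asymptoticallyFree_patternedMatrix {𝕜 : Type*} [RCLike 𝕜] {Ω : Type*} [MeasurableSpace Ω]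
    (μ : Measure Ω) [IsProbabilityMeasure μ]
    (q : Fin 2 → ℕ) (S : (Σ g : Fin 2, Fin (q g)) → Set (ℝ × ℝ))
    (hS : ∀ p, IsPattern (S p)) (hfull : ∀ i : Fin (q 1), S ⟨1, i⟩ = unitSquare)
    (ξ : (Σ g : Fin 2, Fin (q g)) → ℕ → ℕ → Ω → 𝕜) (hξ : ∀ p, IsEntryArray μ (ξ p))
    (hindep : ∀ N : ℕ, iIndepFun
      (fun p ω (ij : Fin N × Fin N) => patternedMatrix N (S p) (ξ p) ω ij.1 ij.2) μ) :
    AsymptoticallyFree μ (fun p : (Σ g : Fin 2, Fin (q g)) => p.1)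
      (fun N p ω => patternedMatrix N (S p) (ξ p) ω) := by
  have hv := fun N => entryMoments hξ (hindep N)
  have hK := momentBound_nonneg μ ξ
  choose T hT using exists_tendsto_avgMoment hS hK hv
  let τ : NCPoly 𝕜 (Σ g : Fin 2, Fin (q g)) →ₗ[𝕜] 𝕜 :=
    (FreeAlgebra.basisFreeMonoid 𝕜 _).constr 𝕜 fun w => T w.toList
  have hτ : ∀ w, τ (monomial 𝕜 w) = T w := fun w => by
    have h : monomial 𝕜 w = FreeAlgebra.basisFreeMonoid 𝕜 _ (FreeMonoid.ofList w) :=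
      (basisFreeMonoid_apply _).symm
    rw [h, Module.Basis.constr_basis, FreeMonoid.toList_ofList]
  have hlim : ∀ P, Tendsto (fun N => expTr μ fun ω =>
      evalPoly (fun p => patternedMatrix N (S p) (ξ p) ω) P) atTop (𝓝 (τ P)) := by
    refine tendsto_expTr_evalPoly (A := fun N p ω => patternedMatrix N (S p) (ξ p) ω)
      (fun N w => integrable_wordProd hξ N w) fun w => ?_
    rw [hτ]
    refine (hT w).congr fun N => ?_
    rw [expTr_wordProd hξ, avgMoment]
  refine ⟨τ, hlim, groupsFree_of_schwingerDyson ?_ ?_ ?_⟩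
  -- Traciality passes to the limit from the matrices.
  · intro P Q
    refine tendsto_nhds_unique (hlim (P * Q)) ((hlim (Q * P)).congr fun N => ?_)
    simp only [expTr, map_mul]
    congr 1
    funext ω
    rw [Matrix.trace_mul_comm]
  · exact apply_one_of_tendsto (hlim 1)
  · rintro ⟨⟨g, i⟩, s⟩ hl w
    obtain rfl : g = 1 := hl
    simp only [hτ]
    exact limit_cons_eq_splitSum hK hv hT (l := (⟨1, i⟩, s)) (hfull i) w

end PatternedMatrices

end

theorem theorem4p5 {𝕜 : Type*} [RCLike 𝕜] {Ω : Type*} [MeasurableSpace Ω]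
    (μ : Measure Ω) [IsProbabilityMeasure μ]
    -- the matrices are numbered by pairs `⟨g, i⟩`: the group `g`, and the place `i` in its tuple
    (q : Fin 2 → ℕ) (S : (Σ g : Fin 2, Fin (q g)) → Set (ℝ × ℝ))
    (hS : ∀ p, IsPattern (S p))
    -- the patterns of the second group are the full square
    (hfull : ∀ i : Fin (q 1), S ⟨1, i⟩ = unitSquare)
    (ξ : (Σ g : Fin 2, Fin (q g)) → ℕ → ℕ → Ω → 𝕜)
    (hξ : ∀ p, IsEntryArray μ (ξ p))
    -- for each size, the patterned matrices are independent
    (hindep : ∀ N : ℕ, iIndepFun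
      (fun p ω (ij : Fin N × Fin N) => patternedMatrix N (S p) (ξ p) ω ij.1 ij.2) μ) :
    (∃ m : (Σ g : Fin 2, Fin (q g)) → Configuration → 𝕜,
      (∀ p C, Tendsto
        (fun N : ℕ => expTr μ fun ω => configPow (patternedMatrix N (S p) (ξ p) ω) C)
        atTop (𝓝 (m p C))) ∧
      ∀ L : List ((Σ g : Fin 2, Fin (q g)) × Configuration), L ≠ [] →
        L.IsChain (fun a b => a.1.1 ≠ b.1.1) →
        Tendsto
          (fun N : ℕ => expTr μ fun ω =>
            (L.map fun a => configPow (patternedMatrix N (S a.1) (ξ a.1) ω) a.2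
              - Matrix.scalar (Fin N) (m a.1 a.2)).prod)
          atTop (𝓝 0)) ∧
    AsymptoticallyFree μ (fun p : (Σ g : Fin 2, Fin (q g)) => p.1)
      (fun N p ω => patternedMatrix N (S p) (ξ p) ω) := by
  obtain ⟨τ, hτ, hfree⟩ := asymptoticallyFree_patternedMatrix μ q S hS hfull ξ hξ hindep
  refine ⟨⟨fun p C => τ (monomial 𝕜 (C.map fun s => (p, s))), fun p C => ?_,
    fun L hne hchain => ?_⟩, τ, hτ, hfree⟩
  · refine (hτ _).congr fun N => ?_
    simp only [evalPoly_monomial_map]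
  -- The first assertion is the instance of freeness in which every factor is a centered monomial in
  -- a single matrix and its adjoint.
  · have h0 := hfree (L.map fun a => (a.1.1, monomial 𝕜 (a.2.map fun s => (a.1, s)) -
      τ (monomial 𝕜 (a.2.map fun s => (a.1, s))) • 1)) (by simpa using hne)
      (by simpa [List.isChain_map] using hchain) (by
        have hone : τ 1 = 1 := apply_one_of_tendsto (hτ 1)
        intro a ha
        obtain ⟨a, -, rfl⟩ := List.mem_map.1 ha
        refine ⟨sub_mem (monomial_mem_groupAlgebra fun l hl => ?_)
          (Subalgebra.smul_mem _ (one_mem _) _), by simp [hone]⟩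
        obtain ⟨s, -, rfl⟩ := List.mem_map.1 hl
        rfl)
    rw [← h0]
    refine (hτ _).congr fun N => ?_
    congr 1
    funext ω
    rw [map_list_prod, List.map_map, List.map_map]
    congr 1
    refine List.map_congr_left fun a _ => ?_
    simp [evalPoly_monomial_map, Matrix.smul_one_eq_diagonal]
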